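/- **Setting.** A *face* of a finitely generated cone $C\subseteq\mathbb R^n$ is an intersection $\{x\in C: f(x)=0\}$ with $f$ linear and nonnegative on $C$ ($f=0$ is allowed). A *conical complex* is a finite set $\Sigma$ of sets (called its faces), together with, for each $c\in\Sigma$, a finitely generated cone $C_c\subseteq\mathbb R^{\delta_c}$ that spans $\mathbb R^{\delta_c}$ and a bijection $\pi_c:C_c\to c$, such that (a) $\pi_c(C')\in\Sigma$ for each face $C'$ of $C_c$, and (b) for all $c,d\in\Sigma$ there are faces $C'$ of $C_c$ and $D'$ of $C_d$ such that $c\cap d=\pi_c(C')\cap\pi_d(D')$ and $\pi_d^{-1}\circ\pi_c$ restricts to a bijection $C'\to D'$ which extends to a linear isomorphism $\mathbb RC'\to\mathbb RD'$. A *monoidal complex* $\mathcal M$ supported by $\Sigma$ consists of finitely generated monoids $M_c\subseteq\mathbb Z^{\delta_c}$, $c\in\Sigma$, with $\mathbb R_+M_c=C_c$, such that for all $c,d\in\Sigma$ the map $\pi_d^{-1}\circ\pi_c$ restricts to a monoid isomorphism $M_c\cap\pi_c^{-1}(c\cap d)\to M_d\cap\pi_d^{-1}(c\cap d)$. We identify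 $C_c$ with $c$ and thus regard the $M_c$ as subsets of $|\Sigma|=\bigcup_{c\in\Sigma}c$; put $|\mathcal M|=\bigcup_{c}M_c$. For a field $K$ the *toric face ring* $K[\mathcal M]$ is the $K$-algebra with $K$-basis $t^a$, $a\in|\mathcal M|$, and $t^at^b=t^{a+b}$ if $a,b\in M_c$ for some $c\in\Sigma$, and $t^at^b=0$ otherwise. Let $(a_e)_{e\in E}$ be a finite family of elements of $|\mathcal M|$ such that $\{a_e:e\in E\}\cap M_c$ generates $M_c$ for each $c\in\Sigma$, and let $w=(w_e)_{e\in E}\in\mathbb N^E$ be a weight vector (with $0\in\mathbb N$). Let $I_{\mathcal M}$ be the kernel of the $K$-algebra homomorphism $K[X_e:e\in E]\to K[\mathcal M]$, $X_e\mapsto t^{a_e}$, and let $\mathrm{in}_w(I_{\mathcal M})$ be the ideal generated by the $w$-initial components $\mathrm{in}_w(f)$, $f\in I_{\mathcal M}$, where $\mathrm{in}_w(f)$ is the $w$-homogeneous component of $f$ of highest $w$-degree ($\deg_wX_e=w_e$). For $c\in\Sigma$ let $C'_c\subseteq\mathbb R^{\delta_c+1}$ be the cone generated by the vectors $(a_e,w_e)$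 with $a_e\in C_c$. The *bottom* of $C'_c$ is the set of all $(x,h)\in C'_c$ with $h=\min\{h':(x,h')\in C'_c\}$. For $x\in|\Sigma|$ let $\mathrm{ht}_w(x)=\min\{h':(x,h')\in C'_c\}$, where $c$ is the smallest face of $\Sigma$ containing $x$. The projections to the cones $C_c$ (along the last coordinate) of those faces of the cones $C'_c$, $c\in\Sigma$, that are contained in the bottom of $C'_c$ are the faces of a conical subdivision $\Gamma_w$ of $\Sigma$; a *facet* of $\Gamma_w$ is a face that is maximal under inclusion. For a face $d$ of $\Gamma_w$ let $D_d$ be the corresponding cone and let $N_{d,w}$ be the monoid generated by all $a_e\in D_d$ with $\mathrm{ht}_w(a_e)=w_e$. **Corollary 3.7.** The ideal $\mathrm{in}_w(I_{\mathcal M})$ is a radical ideal if and only if for every facet $d$ of $\Gamma_w$ one has $N_{d,w}=M_c\cap D_d$, where $c$ is the smallest face of $\Sigma$ containing $d$. -/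

import Mathlib

namespace ToricFace

open scoped NNReal

/-- `F` is a face of the cone `C`: the intersection of `C` with a support hyperplane `{f = 0}`
(`f` linear and nonnegative on `C`); `f = 0` is allowed, so that `C` is a face of itself. -/
def IsFace {V : Type*} [AddCommGroup V] [Module ℝ V] (F C : PointedCone ℝ V) : Prop :=
  ∃ f : V →ₗ[ℝ] ℝ, (∀ x ∈ C, 0 ≤ f x) ∧ ∀ x, x ∈ F ↔ x ∈ C ∧ f x = 0

/-- A conical complex: a finite set of sets (its faces), each of them parametrized by a
full-dimensional (finitely generated) cone `C_c ⊆ ℝ^{δ_c}`. The ambient type `X` only serves to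
have all the faces as subsets of one type. -/
structure ConicalComplex (X : Type*) where
  /-- the set `Σ` of faces -/
  faces : Set (Set X)
  finite_faces : faces.Finite
  /-- the dimension `δ_c` -/
  dim : faces → ℕ
  /-- the cone `C_c`, a cone in `ℝ^{δ_c}` -/
  cone : ∀ c : faces, PointedCone ℝ (Fin (dim c) → ℝ)
  fg_cone : ∀ c, (cone c).FG
  span_cone : ∀ c, Submodule.span ℝ (cone c : Set (Fin (dim c) → ℝ)) = ⊤
  /-- the bijection `π_c : C_c → c` (its values outside `C_c` are irrelevant) -/
  param : ∀ c : faces, (Fin (dim c) → ℝ) → X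
  bijOn_param : ∀ c, Set.BijOn (param c) (cone c) c
  /-- every face of `C_c` is mapped onto a face of the complex -/
  image_face_mem : ∀ (c : faces) (F : PointedCone ℝ (Fin (dim c) → ℝ)), IsFace F (cone c) →
    param c '' (F : Set (Fin (dim c) → ℝ)) ∈ faces
  /-- any two faces `c`, `d` intersect in a common face, and the change of coordinates
  `π_d⁻¹ ∘ π_c` is an isomorphism of cones there, i.e. it is the restriction of a linear
  isomorphism `L` of the linear spans -/
  inter : ∀ c d : faces, ∃ (F : PointedCone ℝ (Fin (dim c) → ℝ))
    (G : PointedCone ℝ (Fin (dim d) → ℝ)), IsFace F (cone c) ∧ IsFace G (cone d) ∧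
    (c : Set X) ∩ d = param c '' (F : Set (Fin (dim c) → ℝ)) ∩
      param d '' (G : Set (Fin (dim d) → ℝ)) ∧
    ∃ L : Submodule.span ℝ (F : Set (Fin (dim c) → ℝ)) ≃ₗ[ℝ]
        Submodule.span ℝ (G : Set (Fin (dim d) → ℝ)),
      ∀ x : Submodule.span ℝ (F : Set (Fin (dim c) → ℝ)),
        ((x : Fin (dim c) → ℝ) ∈ F ↔ (L x : Fin (dim d) → ℝ) ∈ G) ∧
        ((x : Fin (dim c) → ℝ) ∈ F → param c x = param d (L x))

/-- A monoidal complex supported by the conical complex `S`. -/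
structure MonoidalComplex {X : Type*} (S : ConicalComplex X) where
  /-- the monoid `M_c`, a submonoid of `ℝ^{δ_c}` -/
  monoid : ∀ c : S.faces, AddSubmonoid (Fin (S.dim c) → ℝ)
  /-- `M_c` is finitely generated -/
  fg_monoid : ∀ c, (monoid c).FG
  /-- `M_c` is contained in `ℤ^{δ_c}` -/
  integral : ∀ c, ∀ m ∈ monoid c, ∀ i, ∃ z : ℤ, m i = z
  /-- `M_c` generates the cone `C_c` (in particular, it is contained in `C_c`) -/
  hull_monoid : ∀ c,
    PointedCone.hull ℝ (monoid c : Set (Fin (S.dim c) → ℝ)) = S.cone c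
  /-- the change of coordinates `π_d⁻¹ ∘ π_c`, which is the restriction of a linear map on
  `π_c⁻¹ (c ∩ d)`, identifies `M_c ∩ π_c⁻¹ (c ∩ d)` with `M_d ∩ π_d⁻¹ (c ∩ d)` -/
  compat : ∀ c d : S.faces, ∀ x ∈ S.cone c, ∀ y ∈ S.cone d, S.param c x = S.param d y →
    (x ∈ monoid c ↔ y ∈ monoid d)

namespace ConicalComplex

variable {X : Type*} (S : ConicalComplex X)

theorem face_add {V : Type*} [AddCommGroup V] [Module ℝ V] {F C : PointedCone ℝ V}
    (h : IsFace F C) {x y : V} (hx : x ∈ C) (hy : y ∈ C) (hxy : x + y ∈ F) : x ∈ F ∧ y ∈ F := by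
  obtain ⟨f, hf, hF⟩ := h
  have h1 := ((hF _).1 hxy).2
  rw [map_add] at h1
  have h2 := hf x hx
  have h3 := hf y hy
  exact ⟨(hF x).2 ⟨hx, by linarith⟩, (hF y).2 ⟨hy, by linarith⟩⟩

theorem face_le {V : Type*} [AddCommGroup V] [Module ℝ V] {F C : PointedCone ℝ V}
    (h : IsFace F C) {x : V} (hx : x ∈ F) : x ∈ C := by
  obtain ⟨f, hf, hF⟩ := h
  exact ((hF _).1 hx).1

/-- The change of coordinates on the intersection of two faces respects sums, and the
intersection of two faces is closed under taking summands. -/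
theorem param_add (c d : S.faces) :
    (∀ x ∈ S.cone c, ∀ y ∈ S.cone c, ∀ x' ∈ S.cone d, ∀ y' ∈ S.cone d,
      S.param c x = S.param d x' → S.param c y = S.param d y' →
      S.param c (x + y) = S.param d (x' + y')) ∧
    (∀ x ∈ S.cone c, ∀ y ∈ S.cone c, S.param c (x + y) ∈ (d : Set X) →
      S.param c x ∈ (d : Set X) ∧ S.param c y ∈ (d : Set X)) := by
  obtain ⟨F, G, hF, hG, hcd, L, hLL⟩ := S.inter c d
  have hL := fun x => (hLL x).1
  have hLp := fun x => (hLL x).2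
  have key : ∀ x ∈ S.cone c, S.param c x ∈ (d : Set X) → x ∈ F := by
    intro x hx hxd
    have h1 : S.param c x ∈ (c : Set X) ∩ d := ⟨(S.bijOn_param c).mapsTo hx, hxd⟩
    rw [hcd] at h1
    obtain ⟨⟨z, hz, hzx⟩, _⟩ := h1
    rw [← (S.bijOn_param c).injOn (face_le hF hz) hx hzx]
    exact hz
  have key2 : ∀ x (hx : x ∈ F), ∀ x' ∈ S.cone d, S.param c x = S.param d x' →
      (L ⟨x, Submodule.subset_span hx⟩ : Fin (S.dim d) → ℝ) = x' := by
    intro x hx x' hx' hxx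
    refine (S.bijOn_param d).injOn (face_le hG ((hL ⟨x, Submodule.subset_span hx⟩).1 hx)) hx' ?_
    rw [← hLp ⟨x, Submodule.subset_span hx⟩ hx, hxx]
  have key3 : ∀ x ∈ F, S.param c x ∈ (d : Set X) := by
    intro x hx
    rw [hLp ⟨x, Submodule.subset_span hx⟩ hx]
    exact (S.bijOn_param d).mapsTo (face_le hG ((hL ⟨x, Submodule.subset_span hx⟩).1 hx))
  constructor
  · intro x hx y hy x' hx' y' hy' hxx hyy
    have hxF := key x hx (hxx ▸ (S.bijOn_param d).mapsTo hx')
    have hyF := key y hy (hyy ▸ (S.bijOn_param d).mapsTo hy')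
    have h1 := hLp (⟨x, Submodule.subset_span hxF⟩ + ⟨y, Submodule.subset_span hyF⟩)
      (F.add_mem hxF hyF)
    rw [map_add] at h1
    simpa [key2 x hxF x' hx' hxx, key2 y hyF y' hy' hyy] using h1
  · intro x hx y hy hxy
    have := face_add hF hx hy (key _ ((S.cone c).add_mem hx hy) hxy)
    exact ⟨key3 x this.1, key3 y this.2⟩

end ConicalComplex

namespace MonoidalComplex

variable {X : Type*} {S : ConicalComplex X} (M : MonoidalComplex S)

/-- The set `|M|`, the union of the monoids `M_c`, which are considered as subsets of `|Σ|`. -/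
def points : Set X := ⋃ c : S.faces, S.param c '' (M.monoid c : Set (Fin (S.dim c) → ℝ))

/-- The partial addition of `|M|`: `z` is the sum of `x` and `y` in some `M_c`. -/
def IsSum (x y z : X) : Prop :=
  ∃ c : S.faces, ∃ m ∈ M.monoid c, ∃ n ∈ M.monoid c,
    S.param c m = x ∧ S.param c n = y ∧ S.param c (m + n) = z

theorem mem_cone {c : S.faces} {m : Fin (S.dim c) → ℝ} (hm : m ∈ M.monoid c) : m ∈ S.cone c := by
  rw [← M.hull_monoid c]
  exact Submodule.subset_span hm

theorem exists_coord {c d : S.faces} {m : Fin (S.dim c) → ℝ} (hm : m ∈ M.monoid c)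
    (h : S.param c m ∈ (d : Set X)) : ∃ m' ∈ M.monoid d, S.param d m' = S.param c m := by
  obtain ⟨m', hm', h'⟩ := (S.bijOn_param d).surjOn h
  exact ⟨m', (M.compat c d m (M.mem_cone hm) m' hm' h'.symm).1 hm, h'⟩

/-- The sum can be computed in any face. -/
theorem IsSum.param_eq {M : MonoidalComplex S} {x y z : X} (h : M.IsSum x y z) (d : S.faces)
    {m n : Fin (S.dim d) → ℝ} (hm : m ∈ M.monoid d) (hn : n ∈ M.monoid d)
    (hx : S.param d m = x) (hy : S.param d n = y) : S.param d (m + n) = z := by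
  obtain ⟨c, p, hp, q, hq, rfl, rfl, rfl⟩ := h
  exact (S.param_add d c).1 m (M.mem_cone hm) n (M.mem_cone hn) p (M.mem_cone hp) q
    (M.mem_cone hq) hx hy

theorem IsSum.unique {M : MonoidalComplex S} {x y z z' : X} (h : M.IsSum x y z)
    (h' : M.IsSum x y z') : z = z' := by
  obtain ⟨c, m, hm, n, hn, hx, hy, rfl⟩ := h
  exact h'.param_eq c hm hn hx hy

theorem IsSum.symm {M : MonoidalComplex S} {x y z : X} (h : M.IsSum x y z) : M.IsSum y x z := by
  obtain ⟨c, m, hm, n, hn, hx, hy, hz⟩ := h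
  exact ⟨c, n, hn, m, hm, hy, hx, by rw [add_comm]; exact hz⟩

theorem IsSum.mem {M : MonoidalComplex S} {x y z : X} (h : M.IsSum x y z) : z ∈ M.points := by
  obtain ⟨c, m, hm, n, hn, hx, hy, hz⟩ := h
  exact Set.mem_iUnion.2 ⟨c, m + n, add_mem hm hn, hz⟩

theorem IsSum.assoc {M : MonoidalComplex S} {x y z u v : X} (h : M.IsSum x y u)
    (h' : M.IsSum u z v) : ∃ t, M.IsSum y z t ∧ M.IsSum x t v := by
  obtain ⟨c, m, hm, n, hn, rfl, rfl, rfl⟩ := h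
  obtain ⟨d, p, hp, q, hq, hpu, rfl, rfl⟩ := h'
  have hd := (S.param_add c d).2 m (M.mem_cone hm) n (M.mem_cone hn)
    (hpu ▸ (S.bijOn_param d).mapsTo (M.mem_cone hp))
  obtain ⟨m', hm', hmm⟩ := M.exists_coord hm hd.1
  obtain ⟨n', hn', hnn⟩ := M.exists_coord hn hd.2
  have h1 : m' + n' = p := by
    refine (S.bijOn_param d).injOn (M.mem_cone (add_mem hm' hn')) (M.mem_cone hp) ?_
    rw [hpu]
    exact (S.param_add d c).1 m' (M.mem_cone hm') n' (M.mem_cone hn') m (M.mem_cone hm) n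
      (M.mem_cone hn) hmm hnn
  exact ⟨_, ⟨d, n', hn', q, hq, hnn, rfl, rfl⟩,
    ⟨d, m', hm', n' + q, add_mem hn' hq, hmm, rfl, by rw [← h1, add_assoc]⟩⟩

/-- The vector space `K[M] = ⨁_{a ∈ |M|} K t^a`. -/
def FaceRing (M : MonoidalComplex S) (K : Type*) [Field K] := M.points →₀ K

namespace FaceRing

variable {M} {K : Type*} [Field K]

noncomputable instance : AddCommGroup (FaceRing M K) :=
  inferInstanceAs (AddCommGroup (M.points →₀ K))

noncomputable instance : Module K (FaceRing M K) := inferInstanceAs (Module K (M.points →₀ K))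

/-- The monomial `t^a`, `a ∈ |M|`. -/
noncomputable def mono (a : M.points) : FaceRing M K := Finsupp.single a 1

theorem hom_ext {N : Type*} [AddCommMonoid N] [Module K N] {f g : FaceRing M K →ₗ[K] N}
    (h : ∀ a, f (mono a) = g (mono a)) : f = g :=
  Finsupp.lhom_ext' fun a => LinearMap.ext_ring (h a)

open Classical in
/-- The product `t^a * t^b`: it is `t^(a+b)` if `a` and `b` lie in a common `M_c`, and `0`
otherwise. -/
noncomputable def monoMul (a b : M.points) : FaceRing M K :=
  if h : ∃ z, M.IsSum a b z then mono ⟨h.choose, h.choose_spec.mem⟩ else 0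

theorem monoMul_of_isSum {a b : M.points} {z : X} (h : M.IsSum a b z) :
    monoMul a b = (mono ⟨z, h.mem⟩ : FaceRing M K) := by
  have h' : ∃ z, M.IsSum a b z := ⟨z, h⟩
  rw [monoMul, dif_pos h']
  congr 2
  exact h'.choose_spec.unique h

theorem monoMul_eq_zero {a b : M.points} (h : ¬ ∃ z, M.IsSum a b z) :
    monoMul a b = (0 : FaceRing M K) := by
  rw [monoMul, dif_neg h]

/-- Multiplication of `K[M]`, the bilinear extension of the product of monomials. -/
noncomputable def mulHom : FaceRing M K →ₗ[K] FaceRing M K →ₗ[K] FaceRing M K :=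
  Finsupp.linearCombination K fun a => Finsupp.linearCombination K fun b => monoMul a b

theorem mulHom_mono (a b : M.points) :
    mulHom (mono a : FaceRing M K) (mono b) = monoMul a b := by
  simp only [mulHom, mono]
  erw [Finsupp.linearCombination_single, one_smul, Finsupp.linearCombination_single, one_smul]

theorem mulHom_comm (f g : FaceRing M K) : mulHom f g = mulHom g f := by
  have : (mulHom : FaceRing M K →ₗ[K] _) = mulHom.flip := by
    refine hom_ext fun a => hom_ext fun b => ?_
    rw [LinearMap.flip_apply, mulHom_mono, mulHom_mono]
    by_cases h : ∃ z, M.IsSum a b z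
    · obtain ⟨z, hz⟩ := h
      rw [monoMul_of_isSum hz, monoMul_of_isSum hz.symm]
    · rw [monoMul_eq_zero h, monoMul_eq_zero fun ⟨z, hz⟩ => h ⟨z, hz.symm⟩]
  rw [← LinearMap.flip_apply mulHom, ← this]

theorem mulHom_assoc_mono (a b c : M.points) :
    mulHom (mulHom (mono a : FaceRing M K) (mono b)) (mono c) =
      mulHom (mono a) (mulHom (mono b) (mono c)) := by
  rw [mulHom_mono, mulHom_mono]
  by_cases h1 : ∃ z, M.IsSum a b z
  · obtain ⟨u, hu⟩ := h1
    rw [monoMul_of_isSum hu, mulHom_mono]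
    by_cases h2 : ∃ z, M.IsSum u c z
    · obtain ⟨v, hv⟩ := h2
      obtain ⟨t, ht, ht'⟩ := hu.assoc hv
      rw [monoMul_of_isSum (a := ⟨u, hu.mem⟩) hv, monoMul_of_isSum ht, mulHom_mono,
        monoMul_of_isSum (b := ⟨t, ht.mem⟩) ht']
    · rw [monoMul_eq_zero (a := ⟨u, hu.mem⟩) h2]
      by_cases h3 : ∃ z, M.IsSum b c z
      · obtain ⟨t, ht⟩ := h3
        rw [monoMul_of_isSum ht, mulHom_mono, monoMul_eq_zero]
        rintro ⟨v, hv⟩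
        obtain ⟨s, hs, hs'⟩ := ht.symm.assoc hv.symm
        rw [hs.symm.unique hu] at hs'
        exact h2 ⟨v, hs'.symm⟩
      · rw [monoMul_eq_zero h3, map_zero]
  · rw [monoMul_eq_zero h1, map_zero, LinearMap.zero_apply]
    by_cases h3 : ∃ z, M.IsSum b c z
    · obtain ⟨t, ht⟩ := h3
      rw [monoMul_of_isSum ht, mulHom_mono, monoMul_eq_zero]
      rintro ⟨v, hv⟩
      obtain ⟨s, hs, _⟩ := ht.symm.assoc hv.symm
      exact h1 ⟨s, hs.symm⟩
    · rw [monoMul_eq_zero h3, map_zero]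

theorem mulHom_assoc (f g h : FaceRing M K) :
    mulHom (mulHom f g) h = mulHom f (mulHom g h) := by
  have h1 : ∀ a b : M.points, mulHom (mulHom (mono a : FaceRing M K) (mono b)) =
      mulHom (mono a) ∘ₗ mulHom (mono b) :=
    fun a b => hom_ext fun c => mulHom_assoc_mono a b c
  have h2 : ∀ a : M.points, mulHom ∘ₗ mulHom (mono a : FaceRing M K) =
      LinearMap.llcomp K _ _ _ (mulHom (mono a)) ∘ₗ mulHom :=
    fun a => hom_ext fun b => h1 a b
  have h3 : (mulHom (M := M) (K := K)).compr₂ mulHom =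
      LinearMap.lcomp K _ mulHom ∘ₗ LinearMap.llcomp K _ _ _ ∘ₗ mulHom :=
    hom_ext fun a => h2 a
  exact congrArg (fun φ => φ f g h) h3

theorem zero_mem (c : S.faces) : S.param c 0 ∈ M.points :=
  Set.mem_iUnion.2 ⟨c, 0, (M.monoid c).zero_mem, rfl⟩

open Classical in
/-- The unit `t^0` of `K[M]`; if the complex has no faces, then `K[M] = 0`. -/
noncomputable def unit : FaceRing M K :=
  if h : Nonempty S.faces then mono ⟨S.param h.some 0, zero_mem h.some⟩ else 0

theorem mulHom_unit (f : FaceRing M K) : mulHom unit f = f := by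
  have : mulHom (unit : FaceRing M K) = LinearMap.id := by
    refine hom_ext fun a => ?_
    obtain ⟨c, m, hm, hma⟩ := Set.mem_iUnion.1 a.2
    have hne : Nonempty S.faces := ⟨c⟩
    rw [unit, dif_pos hne, mulHom_mono]
    have h0 : S.param hne.some 0 = S.param c 0 := by
      obtain ⟨F, G, hF, hG, hcd, L, hL⟩ := S.inter hne.some c
      have := (hL 0).2 F.zero_mem
      simpa using this
    have hs : M.IsSum (⟨S.param hne.some 0, zero_mem hne.some⟩ : M.points) a a :=
      ⟨c, 0, (M.monoid c).zero_mem, m, hm, h0.symm, hma, by rw [zero_add]; exact hma⟩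
    rw [monoMul_of_isSum hs]
    rfl
  rw [this, LinearMap.id_apply]

/-- The ring structure of the toric face ring `K[M]`. -/
noncomputable instance : CommRing (FaceRing M K) :=
  { (inferInstance : AddCommGroup (FaceRing M K)) with
    mul := fun f g => mulHom f g
    one := unit
    mul_assoc := mulHom_assoc
    mul_comm := mulHom_comm
    one_mul := mulHom_unit
    mul_one := fun f => (mulHom_comm f unit).trans (mulHom_unit f)
    left_distrib := fun f g h => map_add (mulHom f) g h
    right_distrib := fun f g h => LinearMap.map_add₂ mulHom f g h
    zero_mul := fun f => LinearMap.map_zero₂ mulHom f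
    mul_zero := fun f => map_zero (mulHom f) }

/-- The `K`-algebra structure of `K[M]`. -/
noncomputable instance : Algebra K (FaceRing M K) :=
  Algebra.ofModule (fun r f g => LinearMap.map_smul₂ mulHom r f g)
    (fun r f g => map_smul (mulHom f) r g)

end FaceRing

variable {E : Type*}

/-- `{a_e : e ∈ E} ∩ M_c` generates the monoid `M_c` for every face `c`. -/
def Generates (a : E → M.points) : Prop :=
  ∀ c : S.faces, AddSubmonoid.closure
    {m | m ∈ M.monoid c ∧ ∃ e, S.param c m = a e} = M.monoid c

/-- The ideal `I_M`, the kernel of `K[X_e : e ∈ E] → K[M]`, `X_e ↦ t^{a_e}`. -/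
noncomputable def presentationIdeal (K : Type*) [Field K] (a : E → M.points) :
    Ideal (MvPolynomial E K) :=
  RingHom.ker (MvPolynomial.aeval fun e => (FaceRing.mono (a e) : FaceRing M K))

/-- The cone `C'_c ⊆ ℝ^{δ_c} × ℝ` generated by the points `(a_e, w_e)` with `a_e ∈ C_c`. -/
def liftedCone (a : E → M.points) (w : E → ℕ) (c : S.faces) :
    PointedCone ℝ ((Fin (S.dim c) → ℝ) × ℝ) :=
  PointedCone.hull ℝ {p | ∃ e, p.1 ∈ S.cone c ∧ S.param c p.1 = a e ∧ p.2 = w e}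

/-- The bottom of the cone `C'_c`. -/
def bottom (a : E → M.points) (w : E → ℕ) (c : S.faces) : Set ((Fin (S.dim c) → ℝ) × ℝ) :=
  {p | IsLeast {h | (p.1, h) ∈ M.liftedCone a w c} p.2}

/-- The set of faces of the conical subdivision `Γ_w` of `Σ`: the projections to the `C_c` of
those faces of the cones `C'_c` that are contained in the bottom of `C'_c`. -/
def subdivision (a : E → M.points) (w : E → ℕ) : Set (Set X) :=
  {d | ∃ (c : S.faces) (F : PointedCone ℝ ((Fin (S.dim c) → ℝ) × ℝ)),
    IsFace F (M.liftedCone a w c) ∧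
    (F : Set ((Fin (S.dim c) → ℝ) × ℝ)) ⊆ M.bottom a w c ∧
    d = (fun p => S.param c p.1) '' (F : Set ((Fin (S.dim c) → ℝ) × ℝ))}

/-- `d` is a facet, i.e. a maximal face, of `Γ_w`. -/
def IsFacetSubdivision (a : E → M.points) (w : E → ℕ) (d : Set X) : Prop :=
  Maximal (fun d => d ∈ M.subdivision a w) d

/-- `ht_w(x) = h`: if `c` is the minimal face of `Σ` that contains the point `x`, then `h` is
the minimum of all `h'` with `(x, h') ∈ C'_c`. -/
def IsHeight (a : E → M.points) (w : E → ℕ) (x : X) (h : ℝ) : Prop :=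
  ∃ c : S.faces, IsLeast {c : S.faces | x ∈ (c : Set X)} c ∧
    ∃ m ∈ S.cone c, S.param c m = x ∧ IsLeast {h' | (m, h') ∈ M.liftedCone a w c} h

/-- The monoid `N_{d,w}` of a face `d` of `Γ_w`, in the coordinates of a face `c ⊇ d` of `Σ`:
it is generated by all `a_e` in `d` with `ht_w(a_e) = w_e`. -/
def faceMonoid (a : E → M.points) (w : E → ℕ) (c : S.faces) (d : Set X) :
    AddSubmonoid (Fin (S.dim c) → ℝ) :=
  AddSubmonoid.closure {m | m ∈ S.cone c ∧ ∃ e, S.param c m = a e ∧ (a e : X) ∈ d ∧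
    M.IsHeight a w (a e) (w e)}

end MonoidalComplex

/-- The `w`-initial component of a polynomial, its `w`-homogeneous component of highest
degree. -/
noncomputable def initialComponent {E K : Type*} [Field K] (w : E → ℕ) (f : MvPolynomial E K) :
    MvPolynomial E K :=
  MvPolynomial.weightedHomogeneousComponent w (MvPolynomial.weightedTotalDegree w f) f

/-- The `w`-initial ideal of `I`, generated by the initial components of the elements
of `I`. -/
noncomputable def initialIdeal {E K : Type*} [Field K] (w : E → ℕ)
    (I : Ideal (MvPolynomial E K)) : Ideal (MvPolynomial E K) :=
  Ideal.span (initialComponent w '' (I : Set (MvPolynomial E K)))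

end ToricFace

/-!
The residue class ring of `K[X_e]` modulo the initial ideal has a basis consisting of one monomial
for each `x ∈ |M|`: a monomial `X^u` with `∑ u_e a_e = x` of least weight `μ(x)`. The product of
the basis elements of `x` and `y` is that of `x + y` if `μ(x) + μ(y) = μ(x + y)`, and `0` otherwise.
If the ring is reduced, then `μ(n x) = n μ(x)` for all `n`, and since the height `ht_w(x)` is the
minimum of `μ(n x) / n`, this means that `μ` is the height function (`HeightsAttained`).

That `μ` differs from the height function at `x` is first witnessed by a real combination of the
`a_e`; the integrality of the monoids allows one to replace it by a rational one of nearly the same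
weight (`exists_ratLinear_tendsto`, `SupportedIn.exists_weight_lt`). Then `X^(n u)` is the initial
component of a binomial of the ideal, so that `X^u` is nilpotent but nonzero modulo the initial
ideal (`monomial_notMem_initialIdeal`).

Conversely, if `μ` is the height function, then the initial ideal is an intersection of prime
ideals (`initialIdeal_le_ker`, `mem_initialIdeal_of_forall`): every linear function `y` on a cone
`C_c` with `y(a_e) ≤ w_e` defines a homomorphism to a monoid algebra of `ℝ^{δ_c}`, a domain, that
keeps the `X_e` with `a_e ∈ C_c`, `y(a_e) = w_e` and kills the others. By linear programming
duality (`exists_isLeast_height`, derived from Farkas' lemma) each point of `|M|` has such a `y`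
supporting the height function there.

Finally, a face `d` of the subdivision is the projection of a face of the bottom, and therefore
`∑ u_e a_e ∈ d` has height `∑ u_e w_e` if and only if all `a_e` that occur lie in `d` and have
height `w_e` (`exists_face_chart`). Hence `μ` agrees with the height function on `d` if and only if
the monoid `N_{d,w}` contains all elements of `|M|` in `d`; and every element of `|M|` lies in a
facet, because there are only finitely many faces.

The ring `K[M]` itself is used only through `mem_presentationIdeal_iff`: its restrictions to the
faces of the complex embed it into a product of monoid algebras.
-/

namespace ToricFace

open Finsupp (weight)
open MvPolynomial

/-! ### Farkas' lemma and linear programming duality -/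

/-- **Farkas' lemma**: a vector on which every functional that is nonnegative on a finite family
is nonnegative lies in the cone generated by the family. -/
theorem mem_hull_image_of_forall_dual {V ι : Type*} [AddCommGroup V] [Module ℝ V] (s : Finset ι)
    (v : ι → V) (b : V) (h : ∀ f : V →ₗ[ℝ] ℝ, (∀ i ∈ s, 0 ≤ f (v i)) → 0 ≤ f b) :
    b ∈ PointedCone.hull ℝ (v '' s) := by
  classical
  induction s using Finset.induction_on generalizing v b with
  | empty =>
    have : b = 0 := by
      rw [← Module.forall_dual_apply_eq_zero_iff ℝ]
      intro f
      have h1 := h f (by simp)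
      have h2 := h (-f) (by simp)
      rw [LinearMap.neg_apply] at h2
      linarith
    rw [this]
    exact zero_mem _
  | insert m s hm ih =>
    by_cases hs : ∀ f : V →ₗ[ℝ] ℝ, (∀ i ∈ s, 0 ≤ f (v i)) → 0 ≤ f b
    · exact Submodule.span_mono (Set.image_mono (by simp)) (ih v b hs)
    push Not at hs
    obtain ⟨g, hg, hgb⟩ := hs
    have hgm : g (v m) < 0 := by
      by_contra! hc
      refine absurd (h g fun i hi => ?_) (not_le.2 hgb)
      rcases Finset.mem_insert.1 hi with rfl | hi
      · exact hc
      · exact hg i hi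
    have hgm' := hgm.ne
    -- projecting along `v m` onto the hyperplane `g = 0` reduces the number of vectors
    have key := ih (fun i => v i + (g (v i) / -g (v m)) • v m) (b + (g b / -g (v m)) • v m) (by
      intro f hf
      have h1 := h (f + (f (v m) / -g (v m)) • g) (by
        intro i hi
        rcases Finset.mem_insert.1 hi with rfl | hi
        · have : f (v i) + f (v i) / -g (v i) * g (v i) = 0 := by
            field_simp
            ring
          simp [this]
        · have := hf i hi
          simp only [map_add, map_smul, LinearMap.add_apply, LinearMap.smul_apply,
            smul_eq_mul] at this ⊢
          convert this using 2
          ring)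
      simp only [map_add, map_smul, LinearMap.add_apply, LinearMap.smul_apply,
        smul_eq_mul] at h1 ⊢
      convert h1 using 2
      ring)
    have hvm : v m ∈ PointedCone.hull ℝ (v '' (insert m s : Finset ι)) :=
      Submodule.subset_span ⟨m, by simp, rfl⟩
    have h2 : PointedCone.hull ℝ ((fun i => v i + (g (v i) / -g (v m)) • v m) '' s) ≤
        PointedCone.hull ℝ (v '' (insert m s : Finset ι)) := by
      refine Submodule.span_le.2 ?_
      rintro _ ⟨i, hi, rfl⟩
      refine add_mem (Submodule.subset_span ⟨i, by simp_all, rfl⟩)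
        (PointedCone.smul_mem _ (div_nonneg (hg i hi) (by linarith)) hvm)
    have h3 : b = b + (g b / -g (v m)) • v m + (-g b / -g (v m)) • v m := by
      rw [add_assoc, ← add_smul]
      rw [neg_div, add_neg_cancel, zero_smul, add_zero]
    rw [h3]
    exact add_mem (h2 key) (PointedCone.smul_mem _ (div_nonneg (by linarith) (by linarith)) hvm)

theorem exists_dual_neg_of_notMem_hull {V : Type*} [AddCommGroup V] [Module ℝ V] {s : Set V}
    (hs : s.Finite) {b : V} (hb : b ∉ PointedCone.hull ℝ s) :
    ∃ f : V →ₗ[ℝ] ℝ, (∀ x ∈ PointedCone.hull ℝ s, 0 ≤ f x) ∧ f b < 0 := by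
  by_contra! hc
  refine hb ?_
  have := mem_hull_image_of_forall_dual hs.toFinset id b fun f hf => hc f fun x hx => by
    induction hx using Submodule.span_induction with
    | mem x hx => exact hf x (hs.mem_toFinset.2 hx)
    | zero => simp
    | add x y _ _ hx hy => rw [map_add]; exact add_nonneg hx hy
    | smul r x _ hx =>
      change 0 ≤ f ((r : ℝ) • x)
      rw [map_smul]
      exact mul_nonneg r.2 hx
  simpa using this

theorem map_prod_real {V : Type*} [AddCommGroup V] [Module ℝ V] (f : V × ℝ →ₗ[ℝ] ℝ) (x : V)
    (h : ℝ) : f (x, h) = f (x, 0) + h * f (0, 1) := by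
  rw [← smul_eq_mul, ← map_smul, ← map_add]
  simp

/-- Linear programming duality, for a cone in `V × ℝ` generated by a finite set of vectors of
nonnegative height: over a point `z` of the projection the minimal height is attained, and there
is a linear function that is at most the height on the cone and agrees with it over `z`. -/
theorem exists_isLeast_height {V : Type*} [AddCommGroup V] [Module ℝ V] {s : Set (V × ℝ)}
    (hs : s.Finite) (hpos : ∀ p ∈ s, 0 ≤ p.2) {z : V} {h₁ : ℝ}
    (hz : (z, h₁) ∈ PointedCone.hull ℝ s) :
    ∃ (h : ℝ) (y : V →ₗ[ℝ] ℝ), IsLeast {h' | (z, h') ∈ PointedCone.hull ℝ s} h ∧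
      (∀ p ∈ PointedCone.hull ℝ s, y p.1 ≤ p.2) ∧ y z = h := by
  have hpos' : ∀ p ∈ PointedCone.hull ℝ s, 0 ≤ p.2 := by
    intro p hp
    induction hp using Submodule.span_induction with
    | mem x hx => exact hpos x hx
    | zero => simp
    | add x y _ _ hx hy => exact add_nonneg hx hy
    | smul r x _ hx => exact mul_nonneg r.2 hx
  set A := {h' | (z, h') ∈ PointedCone.hull ℝ s} with hA
  have hbdd : BddBelow A := ⟨0, fun h hh => hpos' _ hh⟩
  have hne : A.Nonempty := ⟨h₁, hz⟩
  have hmin : sInf A ∈ A := by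
    by_contra hc
    obtain ⟨f, hf, hfb⟩ := exists_dual_neg_of_notMem_hull hs hc
    have hcl : IsClosed {h : ℝ | 0 ≤ f (z, h)} := by
      have : {h : ℝ | 0 ≤ f (z, h)} = {h : ℝ | 0 ≤ f (z, 0) + h * f (0, 1)} := by
        ext h
        rw [Set.mem_ofPred_eq, map_prod_real f]
        rfl
      rw [this]
      exact isClosed_le continuous_const (by fun_prop)
    have := hcl.closure_subset_iff.2 (fun h hh => hf _ hh : A ⊆ {h : ℝ | 0 ≤ f (z, h)})
      (csInf_mem_closure hne hbdd)
    exact absurd this (not_le.2 hfb)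
  have hleast : IsLeast A (sInf A) := ⟨hmin, fun h hh => csInf_le hbdd hh⟩
  have hnot : ((0, -1) : V × ℝ) ∉ PointedCone.hull ℝ (insert (-(z, sInf A)) s) := by
    intro hc
    obtain ⟨r, p, hp, hrp⟩ := Submodule.mem_span_insert.1 hc
    change (0, -1) = (r : ℝ) • -(z, sInf A) + p at hrp
    have h1 : p = ((r : ℝ) • z, r * sInf A - 1) := by
      rw [Prod.ext_iff] at hrp ⊢
      simp only [Prod.fst_add, Prod.snd_add, Prod.smul_fst, Prod.smul_snd, Prod.fst_neg,
        Prod.snd_neg, smul_neg, smul_eq_mul] at hrp ⊢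
      constructor
      · have := hrp.1
        exact (neg_add_eq_zero.1 this.symm).symm
      · linarith [hrp.2]
    rcases eq_or_lt_of_le r.2 with h0 | h0
    · have := hpos' p hp
      rw [h1] at this
      change 0 ≤ (r : ℝ) * sInf A - 1 at this
      change 0 = (r : ℝ) at h0
      rw [← h0] at this
      linarith
    · change 0 < (r : ℝ) at h0
      have h2 : (z, sInf A - (r : ℝ)⁻¹) ∈ PointedCone.hull ℝ s := by
        have h3 := PointedCone.smul_mem _ (inv_nonneg.2 h0.le) hp
        rw [h1] at h3
        convert h3 using 1
        rw [Prod.smul_mk, smul_smul, inv_mul_cancel₀ h0.ne', one_smul, smul_eq_mul]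
        congr 1
        field_simp
      have := hleast.2 h2
      have := inv_pos.2 h0
      linarith
  obtain ⟨f, hf, hf1⟩ := exists_dual_neg_of_notMem_hull (hs.insert _) hnot
  have hmono : PointedCone.hull ℝ s ≤ PointedCone.hull ℝ (insert (-(z, sInf A)) s) :=
    Submodule.span_mono (Set.subset_insert _ _)
  have hk : 0 < f (0, 1) := by
    have : ((0, -1) : V × ℝ) = -(0, 1) := by simp
    rw [this, map_neg] at hf1
    linarith
  have hle : ∀ p ∈ PointedCone.hull ℝ s,
      ((-(f (0, 1))⁻¹) • (f ∘ₗ LinearMap.inl ℝ V ℝ)) p.1 ≤ p.2 := by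
    rintro ⟨x, h⟩ hp
    have h1 := hf _ (hmono hp)
    rw [map_prod_real f] at h1
    simp only [LinearMap.smul_apply, LinearMap.comp_apply, LinearMap.inl_apply, smul_eq_mul]
    rw [neg_mul, inv_mul_eq_div, neg_le, le_div_iff₀ hk]
    linarith
  refine ⟨sInf A, (-(f (0, 1))⁻¹) • (f ∘ₗ LinearMap.inl ℝ V ℝ), hleast, hle,
    le_antisymm (hle _ hmin) ?_⟩
  have h1 := hf _ (Submodule.subset_span (Set.mem_insert (-(z, sInf A)) s))
  rw [map_neg, map_prod_real f] at h1
  simp only [LinearMap.smul_apply, LinearMap.comp_apply, LinearMap.inl_apply, smul_eq_mul]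
  rw [neg_mul, inv_mul_eq_div, le_neg, div_le_iff₀ hk]
  linarith

/-! ### Rational approximation -/

section RationalApproximation

open Filter Topology

/-- The identity of `ℝ` is a pointwise limit of `ℚ`-linear maps with values in `ℚ` that fix `1`.
Applied to the coefficients of a real solution of a linear system over `ℚ`, these maps produce
rational solutions nearby. -/
theorem exists_ratLinear_tendsto :
    ∃ ψ : ℕ → ℝ →ₗ[ℚ] ℚ, (∀ n, ψ n 1 = 1) ∧
      ∀ x : ℝ, Tendsto (fun n => (ψ n x : ℝ)) atTop (𝓝 x) := by
  classical
  have hli : LinearIndepOn ℚ id ({1} : Set ℝ) := LinearIndepOn.singleton one_ne_zero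
  let b := Module.Basis.extend hli
  have h1 : (1 : ℝ) ∈ hli.extend (Set.subset_univ _) :=
    hli.subset_extend _ (Set.mem_singleton 1)
  have hq : ∀ (n : ℕ) (k : ℝ), ∃ q : ℚ, |k - q| < 1 / ((n : ℝ) + 1) := fun n k =>
    exists_rat_near k (by positivity)
  choose q hq using hq
  let q' : ℕ → hli.extend (Set.subset_univ _) → ℚ := fun n k => if (k : ℝ) = 1 then 1 else q n k
  have hlim : ∀ k : hli.extend (Set.subset_univ _),
      Tendsto (fun n => (q' n k : ℝ)) atTop (𝓝 (k : ℝ)) := by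
    intro k
    by_cases hk : (k : ℝ) = 1
    · simp [q', hk]
    · simp only [q', hk, if_false]
      rw [tendsto_iff_norm_sub_tendsto_zero]
      refine squeeze_zero (fun _ => norm_nonneg _) (fun n => ?_)
        tendsto_one_div_add_atTop_nhds_zero_nat
      rw [Real.norm_eq_abs, abs_sub_comm]
      exact (hq n k).le
  refine ⟨fun n => b.constr ℚ (q' n), fun n => ?_, fun x => ?_⟩
  · have := b.constr_basis ℚ (q' n) ⟨1, h1⟩
    rw [Module.Basis.extend_apply_self] at this
    rw [this]
    simp [q']
  · have hx : x = ∑ k ∈ (b.repr x).support, (b.repr x k : ℝ) * (k : ℝ) := by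
      conv_lhs => rw [← b.linearCombination_repr x]
      rw [Finsupp.linearCombination_apply, Finsupp.sum]
      refine Finset.sum_congr rfl fun k _ => ?_
      rw [Module.Basis.extend_apply_self, Rat.smul_def]
    have hψ : ∀ n, ((b.constr ℚ (q' n) x : ℚ) : ℝ) =
        ∑ k ∈ (b.repr x).support, (b.repr x k : ℝ) * (q' n k : ℝ) := by
      intro n
      rw [Module.Basis.constr_apply, Finsupp.sum]
      push_cast
      simp
    simp_rw [hψ]
    conv => enter [3]; rw [hx]
    exact tendsto_finsetSum _ fun k _ => (hlim k).const_mul _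

/-- If a real nonnegative combination of integral vectors `g i` represents the same vector as the
natural combination `u` and has smaller weight, then a multiple of `u` can be replaced by a natural
combination of smaller weight. -/
theorem exists_nsmul_weight_lt {ι κ : Type*} [Fintype ι] (g : ι → κ → ℝ)
    (hg : ∀ i j, ∃ k : ℤ, g i j = k) (w u : ι → ℕ) (r : ι → ℝ) (hr : ∀ i, 0 ≤ r i)
    (hrg : ∑ i, r i • g i = ∑ i, u i • g i) (hrw : ∑ i, r i * w i < ∑ i, (u i * w i : ℝ)) :
    ∃ n : ℕ, 0 < n ∧ ∃ v : ι → ℕ, ∑ i, v i • g i = n • ∑ i, u i • g i ∧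
      ∑ i, v i * w i < n * ∑ i, u i * w i := by
  obtain ⟨ψ, hψ1, hψ⟩ := exists_ratLinear_tendsto
  have e1 : ∀ᶠ n in atTop, ∀ i, 0 ≤ ψ n (r i) := by
    refine eventually_all.2 fun i => ?_
    rcases (hr i).eq_or_lt with h0 | h0
    · simp [← h0]
    · filter_upwards [(hψ (r i)).eventually_const_lt h0] with n hn
      exact_mod_cast hn.le
  have e2 : ∀ᶠ n in atTop, ∑ i, (ψ n (r i) : ℝ) * w i < ∑ i, (u i * w i : ℝ) :=
    (tendsto_finsetSum _ fun i _ => (hψ (r i)).mul_const _).eventually_lt_const hrw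
  obtain ⟨N, hN1, hN2⟩ := (e1.and e2).exists
  set q : ι → ℚ := fun i => ψ N (r i) with hq
  have hqg : ∀ j, ∑ i, (q i : ℝ) * g i j = ∑ i, (u i : ℝ) * g i j := by
    intro j
    choose k hk using fun i => hg i j
    have h1 := congrArg (ψ N) (congrFun hrg j)
    simp only [Finset.sum_apply, Pi.smul_apply, nsmul_eq_mul, smul_eq_mul, map_sum, hk,
      Pi.mul_apply, Pi.natCast_apply] at h1 ⊢
    have h2 : ∀ i, ψ N (r i * k i) = q i * k i := by
      intro i
      rw [mul_comm, ← zsmul_eq_mul, map_zsmul, zsmul_eq_mul, mul_comm]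
    have h3 : ∀ i, ψ N ((u i : ℝ) * k i) = u i * k i := by
      intro i
      have : ((u i : ℝ) * k i) = ((u i * k i : ℤ)) • (1 : ℝ) := by simp
      rw [this, map_zsmul, hψ1]
      simp
    simp only [h2, h3] at h1
    exact_mod_cast h1
  have hd : ∃ D : ℕ, 0 < D ∧ ∀ i, ∃ v : ℕ, (v : ℚ) = D * q i := by
    refine ⟨∏ i, (q i).den, Finset.prod_pos fun i _ => (q i).den_pos, fun i => ?_⟩
    obtain ⟨t, ht⟩ := Finset.dvd_prod_of_mem (fun i => (q i).den) (Finset.mem_univ i)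
    obtain ⟨m, hm⟩ := Int.eq_ofNat_of_zero_le (Rat.num_nonneg.2 (hN1 i))
    refine ⟨t * m, ?_⟩
    have h1 : ((q i).den : ℚ) * q i = (q i).num := Rat.den_mul_eq_num _
    rw [ht]
    push_cast
    rw [mul_comm ((q i).den : ℚ), mul_assoc, h1, hq, hm]
    simp
  obtain ⟨D, hD, hv⟩ := hd
  choose v hv using hv
  have hv' : ∀ i, (v i : ℝ) = D * (q i : ℝ) := fun i => by
    exact_mod_cast congrArg (Rat.cast (K := ℝ)) (hv i)
  refine ⟨D, hD, v, ?_, ?_⟩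
  · ext j
    simp only [Finset.sum_apply, Pi.smul_apply, nsmul_eq_mul, hv', Pi.mul_apply, Pi.natCast_apply]
    rw [← hqg j, Finset.mul_sum]
    exact Finset.sum_congr rfl fun i _ => by ring
  · have : (∑ i, (v i : ℝ) * w i) < D * ∑ i, (u i : ℝ) * w i := by
      simp only [hv', mul_assoc]
      rw [← Finset.mul_sum]
      exact mul_lt_mul_of_pos_left hN2 (by exact_mod_cast hD)
    exact_mod_cast this

end RationalApproximation

/-! ### Coordinates on a conical complex -/

namespace ConicalComplex

variable {X : Type*} (S : ConicalComplex X)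

/-- The coordinates `π_c⁻¹ x ∈ C_c` of a point `x` of the face `c`; a junk value if `x ∉ c`. -/
noncomputable def coord (c : S.faces) (x : X) : Fin (S.dim c) → ℝ :=
  Function.invFunOn (S.param c) (S.cone c : Set (Fin (S.dim c) → ℝ)) x

variable {S} {c d : S.faces} {x : X}

theorem coord_mem (hx : x ∈ (c : Set X)) : S.coord c x ∈ S.cone c :=
  Function.invFunOn_mem ((S.bijOn_param c).surjOn hx)

theorem param_coord (hx : x ∈ (c : Set X)) : S.param c (S.coord c x) = x :=
  Function.invFunOn_eq ((S.bijOn_param c).surjOn hx)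

theorem param_mem {m : Fin (S.dim c) → ℝ} (hm : m ∈ S.cone c) : S.param c m ∈ (c : Set X) :=
  (S.bijOn_param c).mapsTo hm

theorem coord_param {m : Fin (S.dim c) → ℝ} (hm : m ∈ S.cone c) :
    S.coord c (S.param c m) = m :=
  (S.bijOn_param c).injOn (coord_mem (param_mem hm)) hm (param_coord (param_mem hm))

/-- The points of `c` that lie in `d` are cut out by a linear functional `f` that is nonnegative
on `C_c`, and on them the change of coordinates is given by a linear map `T`. -/
theorem exists_transition (c d : S.faces) :
    ∃ (f : (Fin (S.dim c) → ℝ) →ₗ[ℝ] ℝ)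
      (T : (Fin (S.dim c) → ℝ) →ₗ[ℝ] (Fin (S.dim d) → ℝ)),
      (∀ m ∈ S.cone c, 0 ≤ f m) ∧ ∀ m ∈ S.cone c, (f m = 0 ↔ S.param c m ∈ (d : Set X)) ∧
        (f m = 0 → T m ∈ S.cone d ∧ S.param d (T m) = S.param c m) := by
  obtain ⟨F, G, ⟨f, hf, hF⟩, hG, hcd, L, hL⟩ := S.inter c d
  obtain ⟨T, hT⟩ := LinearMap.exists_extend ((Submodule.subtype _) ∘ₗ L.toLinearMap)
  have hT' : ∀ m ∈ F, T m ∈ G ∧ S.param d (T m) = S.param c m := by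
    intro m hm
    have h1 : T m = L ⟨m, Submodule.subset_span hm⟩ :=
      LinearMap.congr_fun hT ⟨m, Submodule.subset_span hm⟩
    rw [h1]
    exact ⟨((hL _).1).1 hm, ((hL ⟨m, Submodule.subset_span hm⟩).2 hm).symm⟩
  refine ⟨f, T, hf, fun m hm => ⟨⟨fun h => ?_, fun h => ?_⟩, fun h => ?_⟩⟩
  · have := hT' m ((hF m).2 ⟨hm, h⟩)
    rw [← this.2]
    exact param_mem (face_le hG this.1)
  · have h1 : S.param c m ∈ (c : Set X) ∩ d := ⟨param_mem hm, h⟩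
    rw [hcd] at h1
    obtain ⟨⟨z, hz, hzm⟩, -⟩ := h1
    rw [← (S.bijOn_param c).injOn ((hF z).1 hz).1 hm hzm]
    exact ((hF z).1 hz).2
  · have := hT' m ((hF m).2 ⟨hm, h⟩)
    exact ⟨face_le hG this.1, this.2⟩

theorem inter_mem_faces (c d : S.faces) : (c : Set X) ∩ d ∈ S.faces := by
  obtain ⟨F, G, hF, hG, hcd, L, hL⟩ := S.inter c d
  have : (c : Set X) ∩ d = S.param c '' (F : Set (Fin (S.dim c) → ℝ)) := by
    rw [hcd, Set.inter_eq_left]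
    rintro _ ⟨m, hm, rfl⟩
    have h1 := hL ⟨m, Submodule.subset_span hm⟩
    exact ⟨_, h1.1.1 hm, (h1.2 hm).symm⟩
  rw [this]
  exact S.image_face_mem c F hF

/-- A set that is contained in some face is contained in a smallest face. -/
theorem exists_isLeast_face {s : Set X} (hs : s ⊆ c) :
    ∃ c' : S.faces, IsLeast {c' : S.faces | s ⊆ c'} c' := by
  have : Finite S.faces := S.finite_faces
  obtain ⟨c', -, h⟩ := (Set.toFinite {c' : S.faces | s ⊆ c'}).exists_le_minimal hs
  refine ⟨c', h.prop, fun d hd => ?_⟩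
  have h1 : s ⊆ (⟨_, inter_mem_faces c' d⟩ : S.faces) := Set.subset_inter h.prop hd
  exact le_trans (h.le_of_le h1 Set.inter_subset_left) Set.inter_subset_right

end ConicalComplex

/-! ### Heights over a monoidal complex -/

namespace MonoidalComplex

open ConicalComplex

variable {X : Type*} {S : ConicalComplex X} {M : MonoidalComplex S} {E : Type*}

/-- All `a_e` with `u_e ≠ 0` lie in the face `c`. -/
def SupportedIn (a : E → M.points) (c : S.faces) (u : E →₀ ℕ) : Prop :=
  ∀ e ∈ u.support, (a e : X) ∈ (c : Set X)

/-- The vector `∑ u_e a_e` in the coordinates of the face `c`. It is meaningful only if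
`u` is supported in `c`. -/
noncomputable def vec (a : E → M.points) (c : S.faces) : (E →₀ ℕ) →+ (Fin (S.dim c) → ℝ) :=
  weight fun e => S.coord c (a e)

variable {a : E → M.points} {c d : S.faces} {u v : E →₀ ℕ} {w : E → ℕ}

theorem SupportedIn.add_iff : SupportedIn a c (u + v) ↔ SupportedIn a c u ∧ SupportedIn a c v := by
  simp only [SupportedIn, Finsupp.mem_support_iff, Finsupp.add_apply, ne_eq, Nat.add_eq_zero_iff,
    not_and_or]
  exact ⟨fun h => ⟨fun e he => h e (.inl he), fun e he => h e (.inr he)⟩,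
    fun h e he => he.elim (h.1 e) (h.2 e)⟩

theorem SupportedIn.nsmul (h : SupportedIn a c u) (n : ℕ) : SupportedIn a c (n • u) :=
  fun e he => h e (Finsupp.support_smul he)

theorem weight_mem {V : Type*} [AddCommMonoid V] {P : AddSubmonoid V} {g : E → V}
    (h : ∀ e ∈ u.support, g e ∈ P) : weight g u ∈ P := by
  rw [Finsupp.weight_apply]
  exact sum_mem fun e he => nsmul_mem (h e he) _

theorem map_weight {V W F : Type*} [AddCommMonoid V] [AddCommMonoid W] [FunLike F V W]
    [AddMonoidHomClass F V W] (T : F) (g : E → V) :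
    T (weight g u) = weight (fun e => T (g e)) u := by
  simp [Finsupp.weight_apply, Finsupp.sum, map_sum]

theorem weight_congr {V : Type*} [AddCommMonoid V] {g g' : E → V}
    (h : ∀ e ∈ u.support, g e = g' e) : weight g u = weight g' u := by
  rw [Finsupp.weight_apply, Finsupp.weight_apply]
  exact Finset.sum_congr rfl fun e he => by simp only [h e he]

theorem coord_mem_monoid {x : X} (hx : x ∈ M.points) (hc : x ∈ (c : Set X)) :
    S.coord c x ∈ M.monoid c := by
  obtain ⟨d, m, hm, rfl⟩ := Set.mem_iUnion.1 hx
  obtain ⟨m', hm', h⟩ := M.exists_coord hm hc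
  rw [← h, coord_param (M.mem_cone hm')]
  exact hm'

theorem SupportedIn.vec_mem (h : SupportedIn a c u) : vec a c u ∈ M.monoid c :=
  weight_mem fun e he => coord_mem_monoid (a e).2 (h e he)

theorem SupportedIn.vec_mem_cone (h : SupportedIn a c u) : vec a c u ∈ S.cone c :=
  M.mem_cone h.vec_mem

theorem SupportedIn.of_param_mem (h : SupportedIn a c u)
    (hd : S.param c (vec a c u) ∈ (d : Set X)) : SupportedIn a d u := by
  obtain ⟨f, T, hf, hT⟩ := exists_transition c d
  rw [← (hT _ h.vec_mem_cone).1, vec, map_weight, Finsupp.weight_apply, Finsupp.sum,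
    Finset.sum_eq_zero_iff_of_nonneg fun e he => nsmul_nonneg (hf _ (coord_mem (h e he))) _] at hd
  intro e he
  have h1 := hd e he
  rw [smul_eq_zero_iff_right (Finsupp.mem_support_iff.1 he), (hT _ (coord_mem (h e he))).1,
    param_coord (h e he)] at h1
  exact h1

theorem SupportedIn.param_vec_eq (hc : SupportedIn a c u) (hd : SupportedIn a d u) :
    S.param c (vec a c u) = S.param d (vec a d u) := by
  obtain ⟨f, T, hf, hT⟩ := exists_transition c d
  have key : ∀ e ∈ u.support, f (S.coord c (a e)) = 0 ∧ T (S.coord c (a e)) = S.coord d (a e) := by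
    intro e he
    have h1 := (hT _ (coord_mem (hc e he)))
    rw [param_coord (hc e he)] at h1
    have h2 := h1.1.2 (hd e he)
    refine ⟨h2, ?_⟩
    conv_rhs => rw [← (h1.2 h2).2, coord_param (h1.2 h2).1]
  have h1 : f (vec a c u) = 0 := by
    rw [vec, map_weight, weight_congr fun e he => (key e he).1]
    simp [Finsupp.weight_apply]
  have h2 : T (vec a c u) = vec a d u := by
    rw [vec, map_weight, weight_congr fun e he => (key e he).2]
    rfl
  rw [← ((hT _ hc.vec_mem_cone).2 h1).2, h2]

/-- If `u` and `v` have the same sum in one face, then so they have in every face. -/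
theorem SupportedIn.transfer (hu : SupportedIn a c u) (hv : SupportedIn a c v)
    (huv : vec a c u = vec a c v) (hd : SupportedIn a d u) :
    SupportedIn a d v ∧ vec a d u = vec a d v := by
  have h1 := hu.param_vec_eq hd
  have h2 : SupportedIn a d v := hv.of_param_mem (by
    rw [← huv, h1]
    exact param_mem hd.vec_mem_cone)
  refine ⟨h2, (S.bijOn_param d).injOn hd.vec_mem_cone h2.vec_mem_cone ?_⟩
  rw [← h1, ← hv.param_vec_eq h2, huv]

/-- Every element of `M_c` is a sum of elements `a_e`. -/
theorem Generates.exists_vec_eq (ha : M.Generates a) {m : Fin (S.dim c) → ℝ}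
    (hm : m ∈ M.monoid c) : ∃ u, SupportedIn a c u ∧ vec a c u = m := by
  classical
  rw [← ha c] at hm
  induction hm using AddSubmonoid.closure_induction with
  | mem m hm =>
    obtain ⟨hm, e, he⟩ := hm
    refine ⟨Finsupp.single e 1, fun e' he' => ?_, ?_⟩
    · rw [Finset.mem_singleton.1 (Finsupp.support_single_subset he'), ← he]
      exact param_mem (M.mem_cone hm)
    · rw [vec, Finsupp.weight_single, one_smul, ← he, coord_param (M.mem_cone hm)]
  | zero => exact ⟨0, fun e he => by simp at he, map_zero _⟩
  | add m n _ _ hm hn =>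
    obtain ⟨u, hu, rfl⟩ := hm
    obtain ⟨v, hv, rfl⟩ := hn
    exact ⟨u + v, SupportedIn.add_iff.2 ⟨hu, hv⟩, map_add _ _ _⟩

theorem liftedCone_eq_hull_range (a : E → M.points) (w : E → ℕ) (c : S.faces) :
    M.liftedCone a w c = PointedCone.hull ℝ (Set.range fun e : {e // (a e : X) ∈ (c : Set X)} =>
      (S.coord c (a e), (w e : ℝ))) := by
  rw [liftedCone]
  congr 1
  ext p
  constructor
  · rintro ⟨e, h1, h2, h3⟩
    refine ⟨⟨e, h2 ▸ param_mem h1⟩, Prod.ext ?_ h3.symm⟩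
    change S.coord c (a e) = p.1
    rw [← h2, coord_param h1]
  · rintro ⟨e, rfl⟩
    exact ⟨e, coord_mem e.2, param_coord e.2, rfl⟩

theorem gen_mem_liftedCone {e : E} (he : (a e : X) ∈ (c : Set X)) :
    (S.coord c (a e), (w e : ℝ)) ∈ M.liftedCone a w c := by
  rw [liftedCone_eq_hull_range]
  exact Submodule.subset_span ⟨⟨e, he⟩, rfl⟩

theorem fst_mem_cone_of_mem_liftedCone {p : (Fin (S.dim c) → ℝ) × ℝ}
    (hp : p ∈ M.liftedCone a w c) : p.1 ∈ S.cone c := by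
  induction hp using Submodule.span_induction with
  | mem p hp => exact hp.choose_spec.1
  | zero => exact zero_mem _
  | add p q _ _ hp hq => exact add_mem hp hq
  | smul r p _ hp => exact Submodule.smul_mem _ r hp

theorem vec_weight_eq (a : E → M.points) (w : E → ℕ) (c : S.faces) (u : E →₀ ℕ) :
    (vec a c u, (weight w u : ℝ)) = weight (fun e => (S.coord c (a e), (w e : ℝ))) u := by
  rw [vec]
  simp only [Finsupp.weight_apply, Finsupp.sum, Prod.ext_iff, Prod.fst_sum, Prod.snd_sum,
    Prod.fst_mul, Prod.snd_mul, Prod.fst_natCast, Prod.snd_natCast, Nat.cast_sum, smul_eq_mul,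
    nsmul_eq_mul, Nat.cast_mul,
    and_self]

theorem SupportedIn.vec_weight_mem (h : SupportedIn a c u) :
    (vec a c u, (weight w u : ℝ)) ∈ M.liftedCone a w c := by
  rw [vec_weight_eq]
  exact weight_mem (P := (M.liftedCone a w c).toAddSubmonoid) fun e he =>
    gen_mem_liftedCone (h e he)

theorem mem_liftedCone_of_mem_inter {x : X} (hc : x ∈ (c : Set X)) (hd : x ∈ (d : Set X)) {h : ℝ}
    (hx : (S.coord c x, h) ∈ M.liftedCone a w c) : (S.coord d x, h) ∈ M.liftedCone a w d := by
  obtain ⟨f, T, hf, hT⟩ := exists_transition c d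
  have key : ∀ p ∈ M.liftedCone a w c, f p.1 = 0 → (T p.1, p.2) ∈ M.liftedCone a w d := by
    intro p hp
    induction hp using Submodule.span_induction with
    | mem p hp =>
      obtain ⟨e, h1, h2, h3⟩ := hp
      intro h
      have h4 := (hT _ h1).2 h
      exact Submodule.subset_span ⟨e, h4.1, h4.2.trans h2, h3⟩
    | zero =>
      intro
      simp only [Prod.fst_zero, Prod.snd_zero, map_zero]
      exact zero_mem _
    | add p q h1 h2 hp hq =>
      intro h
      rw [Prod.fst_add, map_add] at h
      have h3 := hf _ (fst_mem_cone_of_mem_liftedCone h1)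
      have h4 := hf _ (fst_mem_cone_of_mem_liftedCone h2)
      have := add_mem (hp (by linarith)) (hq (by linarith))
      rwa [Prod.mk_add_mk, ← map_add] at this
    | smul r p h1 hp =>
      intro h
      change f ((r : ℝ) • p.1) = 0 at h
      rw [map_smul, smul_eq_zero] at h
      rcases h with h | h
      · have : r = 0 := Subtype.ext h
        rw [this, zero_smul]
        simp only [Prod.fst_zero, Prod.snd_zero, map_zero]
        exact zero_mem _
      · have := Submodule.smul_mem _ r (hp h)
        convert this using 1
        exact Prod.ext (map_smul T (r : ℝ) p.1) rfl
  have h1 := hT _ (coord_mem hc)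
  rw [param_coord hc] at h1
  have h2 := h1.2 (h1.1.2 hd)
  have h3 := key _ hx (h1.1.2 hd)
  rwa [← coord_param h2.1, h2.2] at h3

/-- The height of a point can be computed in any face that contains it. -/
theorem isHeight_iff {x : X} (hx : x ∈ (c : Set X)) {h : ℝ} :
    M.IsHeight a w x h ↔ IsLeast {h' | (S.coord c x, h') ∈ M.liftedCone a w c} h := by
  have key : ∀ d : S.faces, x ∈ (d : Set X) →
      {h' | (S.coord d x, h') ∈ M.liftedCone a w d} =
        {h' | (S.coord c x, h') ∈ M.liftedCone a w c} := fun d hd => Set.ext fun h' =>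
    ⟨mem_liftedCone_of_mem_inter hd hx, mem_liftedCone_of_mem_inter hx hd⟩
  constructor
  · rintro ⟨d, hd, m, hm, rfl, h1⟩
    rw [← key d hd.1, coord_param hm]
    exact h1
  · intro h1
    obtain ⟨d, hd⟩ := exists_isLeast_face (Set.singleton_subset_iff.2 hx)
    simp only [Set.singleton_subset_iff] at hd
    refine ⟨d, hd, S.coord d x, coord_mem hd.1, param_coord hd.1, ?_⟩
    rwa [key d hd.1]

theorem IsHeight.unique {x : X} (hx : x ∈ (c : Set X)) {h h' : ℝ} (h1 : M.IsHeight a w x h)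
    (h2 : M.IsHeight a w x h') : h = h' :=
  ((isHeight_iff hx).1 h1).unique ((isHeight_iff hx).1 h2)

theorem SupportedIn.isHeight_iff (hu : SupportedIn a c u) {h : ℝ} :
    M.IsHeight a w (S.param c (vec a c u)) h ↔
      IsLeast {h' | (vec a c u, h') ∈ M.liftedCone a w c} h := by
  rw [MonoidalComplex.isHeight_iff (param_mem hu.vec_mem_cone), coord_param hu.vec_mem_cone]

/-- Every point `∑ u_e a_e` has a height, and some linear function `y` on `C_c` supports the height
function there: it is bounded by the heights of all points, and equal to the height at this
point. -/
theorem SupportedIn.exists_isHeight [Finite E] (w : E → ℕ) (hu : SupportedIn a c u) :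
    ∃ (h : ℝ) (y : (Fin (S.dim c) → ℝ) →ₗ[ℝ] ℝ),
      M.IsHeight a w (S.param c (vec a c u)) h ∧
      (∀ p ∈ M.liftedCone a w c, y p.1 ≤ p.2) ∧ y (vec a c u) = h := by
  have hm := hu.vec_weight_mem (w := w)
  simp only [hu.isHeight_iff]
  rw [liftedCone_eq_hull_range] at hm ⊢
  refine exists_isLeast_height (Set.finite_range _) ?_ hm
  rintro _ ⟨e, rfl⟩
  exact Nat.cast_nonneg _

/-- If the weight of `u` is not the height of the point `∑ u_e a_e`, then some multiple of this
point is the sum of some `v` of smaller weight than the multiple of `u`. -/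
theorem SupportedIn.exists_weight_lt [Finite E] (hu : SupportedIn a c u) {h : ℝ}
    (hh : (vec a c u, h) ∈ M.liftedCone a w c) (hlt : h < weight w u) :
    ∃ n : ℕ, 0 < n ∧ ∃ v, SupportedIn a c v ∧ vec a c (n • u) = vec a c v ∧
      weight w v < weight w (n • u) := by
  classical
  have := Fintype.ofFinite E
  rw [liftedCone_eq_hull_range] at hh
  obtain ⟨r, hr⟩ := (Submodule.mem_span_range_iff_exists_fun _).1 hh
  have hsum : ∀ {V : Type} [AddCommMonoid V] (g : E → V),
      ∑ e : {e // (a e : X) ∈ (c : Set X)}, u e • g e = weight g u := by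
    intro V _ g
    rw [Finsupp.weight_apply, ← Finsupp.sum_subtypeDomain_index hu,
      Finsupp.sum_fintype _ _ (by simp)]
    rfl
  obtain ⟨n, hn, v, hv1, hv2⟩ := exists_nsmul_weight_lt
    (fun e : {e // (a e : X) ∈ (c : Set X)} => S.coord c (a e))
    (fun e => M.integral c _ (coord_mem_monoid (a e).2 e.2)) (fun e => w e) (fun e => u e)
    (fun e => (r e : ℝ)) (fun e => (r e).2) (by
      have := congrArg Prod.fst hr
      rw [Prod.fst_sum] at this
      rw [hsum fun e => S.coord c (a e)]
      exact this) (by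
      have := congrArg Prod.snd hr
      rw [Prod.snd_sum] at this
      change ∑ e, (r e : ℝ) * (w e : ℝ) = h at this
      rw [this]
      refine hlt.trans_eq ?_
      rw [← hsum w]
      push_cast
      simp)
  rw [hsum fun e => S.coord c (a e)] at hv1
  simp only [← smul_eq_mul] at hv2
  rw [hsum w] at hv2
  have hext : ∀ {V : Type} [AddCommMonoid V] (g : E → V),
      weight g (Finsupp.mapDomain Subtype.val (Finsupp.equivFunOnFinite.symm v)) =
        ∑ e : {e // (a e : X) ∈ (c : Set X)}, v e • g e := by
    intro V _ g
    rw [Finsupp.weight_apply, Finsupp.sum_mapDomain_index (by simp) (by simp [add_smul]),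
      Finsupp.sum_fintype _ _ (by simp)]
    rfl
  refine ⟨n, hn, Finsupp.mapDomain Subtype.val (Finsupp.equivFunOnFinite.symm v), ?_, ?_, ?_⟩
  · intro e he
    obtain ⟨e', -, rfl⟩ := Finset.mem_image.1 (Finsupp.mapDomain_support he)
    exact e'.2
  · rw [map_nsmul, vec, hext, hv1]
  · rw [map_nsmul, hext]
    exact hv2

end MonoidalComplex

/-! ### Faces of the conical subdivision -/

/-- A face of a cone is generated by the generators of the cone that it contains. -/
theorem IsFace.eq_hull_inter {V : Type*} [AddCommGroup V] [Module ℝ V] {s : Set V}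
    {F : PointedCone ℝ V} (hF : IsFace F (PointedCone.hull ℝ s)) :
    F = PointedCone.hull ℝ (s ∩ F) := by
  obtain ⟨f, hf, hF⟩ := hF
  refine le_antisymm (fun x hx => ?_) (Submodule.span_le.2 Set.inter_subset_right)
  obtain ⟨h1, h2⟩ := (hF x).1 hx
  clear hx
  induction h1 using Submodule.span_induction with
  | mem x hx => exact Submodule.subset_span ⟨hx, (hF x).2 ⟨Submodule.subset_span hx, h2⟩⟩
  | zero => exact zero_mem _
  | add x y hx hy ihx ihy =>
    rw [map_add] at h2
    have h3 := hf x hx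
    have h4 := hf y hy
    exact add_mem (ihx (by linarith)) (ihy (by linarith))
  | smul r x hx ih =>
    change f ((r : ℝ) • x) = 0 at h2
    rw [map_smul, smul_eq_zero] at h2
    rcases h2 with h2 | h2
    · rw [show r = 0 from Subtype.ext h2, zero_smul]
      exact zero_mem _
    · exact Submodule.smul_mem _ r (ih h2)

namespace MonoidalComplex

open ConicalComplex

variable {X : Type*} {S : ConicalComplex X} {M : MonoidalComplex S} {E : Type*}
  {a : E → M.points} {c : S.faces} {u : E →₀ ℕ} {w : E → ℕ} {d : Set X}

theorem finite_subdivision [Finite E] (a : E → M.points) (w : E → ℕ) :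
    (M.subdivision a w).Finite := by
  have : Finite S.faces := S.finite_faces
  have hfin : (⋃ c : S.faces, (fun t : Set ((Fin (S.dim c) → ℝ) × ℝ) =>
      (fun p => S.param c p.1) '' (PointedCone.hull ℝ t : Set ((Fin (S.dim c) → ℝ) × ℝ))) ''
      (Set.range fun e : {e // (a e : X) ∈ (c : Set X)} =>
        (S.coord c (a e), (w e : ℝ))).powerset).Finite :=
    Set.finite_iUnion fun c => (Set.finite_range _).finite_subsets.image _
  refine hfin.subset ?_
  rintro _ ⟨c, F, hF, -, rfl⟩
  rw [liftedCone_eq_hull_range] at hF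
  refine Set.mem_iUnion.2 ⟨c, _ ∩ (F : Set ((Fin (S.dim c) → ℝ) × ℝ)),
    Set.inter_subset_left, ?_⟩
  dsimp only
  rw [← hF.eq_hull_inter]

/-- Every element of `|M|` lies in a face of the subdivision: a linear function that supports the
height function at this element cuts out a face of the bottom. -/
theorem SupportedIn.exists_mem_subdivision [Finite E] (w : E → ℕ) (hu : SupportedIn a c u) :
    ∃ d ∈ M.subdivision a w, S.param c (vec a c u) ∈ d := by
  obtain ⟨h, y, hh, hy, hyu⟩ := hu.exists_isHeight w
  have hh' := hu.isHeight_iff.1 hh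
  refine ⟨_, ⟨c, M.liftedCone a w c ⊓ PointedCone.ofSubmodule
    (LinearMap.ker (LinearMap.snd ℝ (Fin (S.dim c) → ℝ) ℝ - y ∘ₗ LinearMap.fst ℝ _ ℝ)),
    ⟨LinearMap.snd ℝ (Fin (S.dim c) → ℝ) ℝ - y ∘ₗ LinearMap.fst ℝ _ ℝ,
      fun p hp => sub_nonneg.2 (hy p hp), fun p => Iff.rfl⟩, ?_, rfl⟩,
    (vec a c u, h), ⟨hh'.1, LinearMap.mem_ker.2 (sub_eq_zero.2 hyu.symm)⟩, rfl⟩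
  rintro p ⟨hp, hp0⟩
  have hp1 : p.2 = y p.1 := sub_eq_zero.1 hp0
  refine ⟨hp, fun h' hh' => ?_⟩
  rw [hp1]
  exact hy _ hh'

/-- The face structure of the bottom in combinatorial terms: `∑ u_e a_e` lies in the face `d` of
the subdivision and has height `∑ u_e w_e` if and only if all the `a_e` that occur lie in `d` and
have height `w_e`. -/
theorem exists_face_chart (hd : d ∈ M.subdivision a w) :
    ∃ c : S.faces, d ⊆ c ∧ ∀ u, SupportedIn a c u →
      ((S.param c (vec a c u) ∈ d ∧ M.IsHeight a w (S.param c (vec a c u)) (weight w u : ℕ)) ↔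
        ∀ e ∈ u.support, (a e : X) ∈ d ∧ M.IsHeight a w (a e) (w e)) := by
  obtain ⟨c, F, ⟨f, hf, hF⟩, hb, rfl⟩ := hd
  refine ⟨c, ?_, fun u hu => ?_⟩
  · rintro _ ⟨p, hp, rfl⟩
    exact param_mem (fst_mem_cone_of_mem_liftedCone ((hF p).1 hp).1)
  -- a point lies in `d` and has height `h` iff `(point, h)` lies in the face `F` of the bottom
  have key : ∀ m ∈ S.cone c, ∀ h : ℝ,
      (S.param c m ∈ (fun p => S.param c p.1) '' (F : Set ((Fin (S.dim c) → ℝ) × ℝ)) ∧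
        M.IsHeight a w (S.param c m) h) ↔ (m, h) ∈ F := by
    intro m hm h
    rw [isHeight_iff (param_mem hm), coord_param hm]
    constructor
    · rintro ⟨⟨p, hp, hpm⟩, hh⟩
      have h1 : p.1 = m :=
        (S.bijOn_param c).injOn (fst_mem_cone_of_mem_liftedCone ((hF p).1 hp).1) hm hpm
      have h2 : IsLeast _ p.2 := hb hp
      rw [h1] at h2
      rw [hh.unique h2, ← h1]
      exact hp
    · intro h1
      exact ⟨⟨_, h1, rfl⟩, hb h1⟩
  have key' : ∀ e ∈ u.support, (((a e : X) ∈ (fun p => S.param c p.1) ''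
      (F : Set ((Fin (S.dim c) → ℝ) × ℝ)) ∧ M.IsHeight a w (a e) (w e)) ↔
        f (S.coord c (a e), (w e : ℝ)) = 0) := by
    intro e he
    have := key _ (coord_mem (hu e he)) (w e)
    rw [param_coord (hu e he)] at this
    rw [this, hF, and_iff_right (gen_mem_liftedCone (hu e he))]
  rw [key _ hu.vec_mem_cone, hF, and_iff_right hu.vec_weight_mem, vec_weight_eq, map_weight,
    Finsupp.weight_apply, Finsupp.sum, Finset.sum_eq_zero_iff_of_nonneg fun e he =>
      nsmul_nonneg (hf _ (gen_mem_liftedCone (hu e he))) _]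
  refine forall₂_congr fun e he => ?_
  rw [key' e he, smul_eq_zero_iff_right (Finsupp.mem_support_iff.1 he)]

theorem mem_faceMonoid_iff (hd : d ⊆ c) {m : Fin (S.dim c) → ℝ} :
    m ∈ M.faceMonoid a w c d ↔
      ∃ u, (∀ e ∈ u.support, (a e : X) ∈ d ∧ M.IsHeight a w (a e) (w e)) ∧ vec a c u = m := by
  classical
  constructor
  · intro hm
    induction hm using AddSubmonoid.closure_induction with
    | mem m hm =>
      obtain ⟨hm, e, he, he'⟩ := hm
      refine ⟨Finsupp.single e 1, fun e' h => ?_, ?_⟩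
      · rw [Finset.mem_singleton.1 (Finsupp.support_single_subset h)]
        exact he'
      · rw [vec, Finsupp.weight_single, one_smul, ← he, coord_param hm]
    | zero => exact ⟨0, fun e he => by simp at he, map_zero _⟩
    | add m n _ _ hm hn =>
      obtain ⟨u, hu, rfl⟩ := hm
      obtain ⟨v, hv, rfl⟩ := hn
      refine ⟨u + v, fun e he => ?_, map_add _ _ _⟩
      exact (Finset.mem_union.1 (Finsupp.support_add he)).elim (hu e) (hv e)
  · rintro ⟨u, hu, rfl⟩
    exact weight_mem fun e he => AddSubmonoid.subset_closure
      ⟨coord_mem (hd (hu e he).1), e, param_coord (hd (hu e he).1), hu e he⟩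

/-- The heights of all points of `|M|` are attained by the weights of nonnegative integral
combinations of the `a_e`. -/
def HeightsAttained (a : E → M.points) (w : E → ℕ) : Prop :=
  ∀ (c : S.faces) (u : E →₀ ℕ), SupportedIn a c u → ∃ v, SupportedIn a c v ∧
    vec a c v = vec a c u ∧ M.IsHeight a w (S.param c (vec a c v)) (weight w v : ℕ)

theorem HeightsAttained.faceMonoid_eq (ha : M.Generates a) (h : HeightsAttained a w)
    (hd : d ∈ M.subdivision a w) (hc : d ⊆ c) :
    (M.faceMonoid a w c d : Set (Fin (S.dim c) → ℝ)) =
      {m | m ∈ M.monoid c ∧ S.param c m ∈ d} := by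
  obtain ⟨c', hc', hd'⟩ := exists_face_chart hd
  ext m
  rw [SetLike.mem_coe, mem_faceMonoid_iff hc]
  constructor
  · rintro ⟨u, hu, rfl⟩
    have h1 : SupportedIn a c u := fun e he => hc (hu e he).1
    have h2 : SupportedIn a c' u := fun e he => hc' (hu e he).1
    refine ⟨h1.vec_mem, ?_⟩
    rw [h1.param_vec_eq h2]
    exact ((hd' u h2).2 hu).1
  · rintro ⟨hm, hmd⟩
    obtain ⟨u, hu, rfl⟩ := ha.exists_vec_eq hm
    obtain ⟨v, hv, hvu, hvh⟩ := h c u hu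
    rw [← hvu] at hmd
    have h2 : SupportedIn a c' v := hv.of_param_mem (hc' hmd)
    rw [hv.param_vec_eq h2] at hvh hmd
    exact ⟨v, (hd' v h2).1 ⟨hmd, hvh⟩, hvu⟩

theorem heightsAttained_of_faceMonoid_eq [Finite E]
    (h : ∀ d : Set X, M.IsFacetSubdivision a w d → ∃ c : S.faces, d ⊆ c ∧
      (M.faceMonoid a w c d : Set (Fin (S.dim c) → ℝ)) =
        {m | m ∈ M.monoid c ∧ S.param c m ∈ d}) : HeightsAttained a w := by
  intro c u hu
  obtain ⟨d₀, hd₀, hud₀⟩ := hu.exists_mem_subdivision w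
  obtain ⟨d, hdd, hd⟩ := (finite_subdivision a w).exists_le_maximal hd₀
  obtain ⟨c₁, hc₁, hN⟩ := h d hd
  obtain ⟨c₂, hc₂, hch⟩ := exists_face_chart hd.prop
  have hud : S.param c (vec a c u) ∈ d := hdd hud₀
  have hu₁ : SupportedIn a c₁ u := hu.of_param_mem (hc₁ hud)
  have hmem : vec a c₁ u ∈ (M.faceMonoid a w c₁ d : Set (Fin (S.dim c₁) → ℝ)) := by
    rw [hN]
    exact ⟨hu₁.vec_mem, hu.param_vec_eq hu₁ ▸ hud⟩
  obtain ⟨v, hv, hvu⟩ := (mem_faceMonoid_iff hc₁).1 hmem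
  have hv₁ : SupportedIn a c₁ v := fun e he => hc₁ (hv e he).1
  have hv₂ : SupportedIn a c₂ v := fun e he => hc₂ (hv e he).1
  obtain ⟨hvc, hvc'⟩ := hu₁.transfer hv₁ hvu.symm hu
  refine ⟨v, hvc, hvc'.symm, ?_⟩
  rw [hvc.param_vec_eq hv₂]
  exact ((hch v hv₂).2 hv).2

end MonoidalComplex

/-! ### Homomorphisms to monoid algebras -/

section MonomialHom

variable {E K V : Type*} [Field K] [AddCommGroup V]

open Classical in
/-- The `K`-algebra homomorphism from a polynomial ring to the monoid algebra of `V` that maps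
the indeterminate `X_e` to the monomial with exponent `g e` if `e ∈ T`, and to `0` otherwise. -/
noncomputable def monomialHom (K : Type*) [Field K] (T : Set E) (g : E → V) :
    MvPolynomial E K →ₐ[K] AddMonoidAlgebra K V :=
  aeval fun e => if e ∈ T then AddMonoidAlgebra.single (g e) 1 else 0

open Classical in
theorem monomialHom_monomial (T : Set E) (g : E → V) (u : E →₀ ℕ) (r : K) :
    monomialHom K T g (monomial u r) =
      if ∀ e ∈ u.support, e ∈ T then AddMonoidAlgebra.single (weight g u) r else 0 := by
  rw [monomialHom, aeval_monomial, Finsupp.prod]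
  split_ifs with h
  · rw [Finset.prod_congr rfl fun e he => by rw [if_pos (h e he)]]
    simp only [AddMonoidAlgebra.single_pow, one_pow]
    have : ∀ s : Finset E, ∏ e ∈ s, (AddMonoidAlgebra.single (u e • g e) 1 : AddMonoidAlgebra K V) =
        AddMonoidAlgebra.single (∑ e ∈ s, u e • g e) 1 := by
      intro s
      induction s using Finset.induction_on with
      | empty => simp [AddMonoidAlgebra.one_def]
      | insert e s he ih =>
        rw [Finset.prod_insert he, ih, Finset.sum_insert he, AddMonoidAlgebra.single_mul_single,
          one_mul]
    rw [this, ← Algebra.smul_def, AddMonoidAlgebra.smul_single, smul_eq_mul, mul_one]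
    rfl
  · push Not at h
    obtain ⟨e, he, heT⟩ := h
    rw [Finset.prod_eq_zero he, mul_zero]
    rw [if_neg heT, zero_pow (Finsupp.mem_support_iff.1 he)]

open Classical in
theorem coeff_monomialHom (T : Set E) (g : E → V) (f : MvPolynomial E K)
    {s : Finset (E →₀ ℕ)} (hs : f.support ⊆ s) (z : V) :
    (monomialHom K T g f).coeff z =
      ∑ u ∈ s, if (∀ e ∈ u.support, e ∈ T) ∧ weight g u = z then MvPolynomial.coeff u f else 0 := by
  have hf : f = ∑ u ∈ s, monomial u (MvPolynomial.coeff u f) := by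
    conv_lhs => rw [f.as_sum]
    exact Finset.sum_subset hs fun u _ hu => by rw [notMem_support_iff.1 hu, monomial_zero]
  conv_lhs => rw [hf, map_sum, AddMonoidAlgebra.coeff_sum, Finsupp.finsetSum_apply]
  refine Finset.sum_congr rfl fun u _ => ?_
  rw [monomialHom_monomial, ite_and]
  split_ifs with h1 h2
  · rw [AddMonoidAlgebra.coeff_single, h2, Finsupp.single_eq_same]
  · rw [AddMonoidAlgebra.coeff_single, Finsupp.single_eq_of_ne (Ne.symm h2)]
  · rfl

theorem isPrime_ker_monomialHom [Module ℝ V] (T : Set E) (g : E → V) :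
    (RingHom.ker (monomialHom K T g)).IsPrime := by
  have : Module ℚ V := Module.compHom V (algebraMap ℚ ℝ)
  exact RingHom.ker_isPrime _

end MonomialHom

/-! ### Initial ideals -/

section InitialIdeal

variable {E K : Type*} [Field K] {w : E → ℕ} {I : Ideal (MvPolynomial E K)}

theorem weightedHomogeneousComponent_monomial (N : ℕ) (u : E →₀ ℕ) (r : K) :
    weightedHomogeneousComponent w N (monomial u r) =
      if weight w u = N then monomial u r else 0 := by
  classical
  ext t
  rw [coeff_weightedHomogeneousComponent, coeff_monomial]
  by_cases h : u = t
  · subst h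
    by_cases hu : weight w u = N
    · rw [if_pos hu, if_pos hu, coeff_monomial]
    · rw [if_neg hu, if_neg hu, coeff_zero]
  · rw [if_neg h, ite_self]
    split_ifs <;> simp [h]

theorem weightedHomogeneousComponent_mem_initialIdeal {f : MvPolynomial E K} (hf : f ∈ I) {N : ℕ}
    (hN : ∀ u ∈ f.support, weight w u ≤ N) :
    weightedHomogeneousComponent w N f ∈ initialIdeal w I := by
  have h1 : weightedTotalDegree w f ≤ N := Finset.sup_le hN
  rcases h1.eq_or_lt with h1 | h1
  · rw [← h1]
    exact Ideal.subset_span ⟨f, hf, rfl⟩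
  · rw [weightedHomogeneousComponent_eq_zero' _ _ fun u hu =>
      ((le_weightedTotalDegree w hu).trans_lt h1).ne]
    exact zero_mem _

/-- The homogeneous components of the elements of the initial ideal are top components of elements
of the ideal. -/
theorem exists_mem_of_mem_initialIdeal {g : MvPolynomial E K} (hg : g ∈ initialIdeal w I)
    (N : ℕ) : ∃ f ∈ I, (∀ u ∈ f.support, weight w u ≤ N) ∧
      ∀ u, weight w u = N → MvPolynomial.coeff u f = MvPolynomial.coeff u g := by
  induction hg using Submodule.span_induction generalizing N with
  | mem g hg =>
    obtain ⟨f, hf, rfl⟩ := hg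
    by_cases hN : weightedTotalDegree w f = N
    · refine ⟨f, hf, fun u hu => hN ▸ le_weightedTotalDegree w hu, fun u hu => ?_⟩
      rw [initialComponent, coeff_weightedHomogeneousComponent, if_pos (hu.trans hN.symm)]
    · refine ⟨0, zero_mem _, by simp, fun u hu => ?_⟩
      rw [initialComponent, coeff_weightedHomogeneousComponent,
        if_neg fun h => hN (h.symm.trans hu), coeff_zero]
  | zero => exact ⟨0, zero_mem _, by simp, by simp⟩
  | add g g' _ _ hg hg' =>
    classical
    obtain ⟨f, hf, h1, h2⟩ := hg N
    obtain ⟨f', hf', h1', h2'⟩ := hg' N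
    refine ⟨f + f', add_mem hf hf', fun u hu => ?_, fun u hu => ?_⟩
    · exact (Finset.mem_union.1 (MvPolynomial.support_add hu)).elim (h1 u) (h1' u)
    · rw [MvPolynomial.coeff_add, MvPolynomial.coeff_add, h2 u hu, h2' u hu]
  | smul p g _ hg =>
    classical
    rw [smul_eq_mul]
    induction p using MvPolynomial.induction_on' generalizing N with
    | monomial s r =>
      by_cases hs : weight w s ≤ N
      · obtain ⟨f, hf, h1, h2⟩ := hg (N - weight w s)
        refine ⟨monomial s r * f, I.mul_mem_left _ hf, fun u hu => ?_, fun u hu => ?_⟩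
        · rw [mem_support_iff, coeff_monomial_mul'] at hu
          split_ifs at hu with hsu
          · have h3 := h1 (u - s) (mem_support_iff.2 (right_ne_zero_of_mul hu))
            have h4 : weight w u = weight w s + weight w (u - s) := by
              rw [← map_add, add_tsub_cancel_of_le hsu]
            omega
          · exact absurd rfl hu
        · rw [coeff_monomial_mul', coeff_monomial_mul']
          split_ifs with hsu
          · have h4 : weight w u = weight w s + weight w (u - s) := by
              rw [← map_add, add_tsub_cancel_of_le hsu]
            rw [h2 _ (by omega)]
          · rfl
      · refine ⟨0, zero_mem _, by simp, fun u hu => ?_⟩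
        rw [coeff_monomial_mul', if_neg, coeff_zero]
        intro hsu
        have h4 : weight w u = weight w s + weight w (u - s) := by
          rw [← map_add, add_tsub_cancel_of_le hsu]
        omega
    | add p q hp hq =>
      obtain ⟨f, hf, h1, h2⟩ := hp N
      obtain ⟨f', hf', h1', h2'⟩ := hq N
      refine ⟨f + f', add_mem hf hf', fun u hu => ?_, fun u hu => ?_⟩
      · exact (Finset.mem_union.1 (MvPolynomial.support_add hu)).elim (h1 u) (h1' u)
      · rw [MvPolynomial.coeff_add, h2 u hu, h2' u hu, ← MvPolynomial.coeff_add, add_mul]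

end InitialIdeal

namespace MonoidalComplex

open ConicalComplex

variable {X : Type*} {S : ConicalComplex X} {M : MonoidalComplex S} {E : Type*}
  {a : E → M.points} {c : S.faces} {u v : E →₀ ℕ} {w : E → ℕ} {K : Type*} [Field K]

/-! ### The presentation ideal -/

open Classical in
/-- The `K`-linear map from `K[M]` to the monoid algebra of `ℝ^{δ_c}` that maps the monomials in
`M_c` to their coordinates and kills all other monomials. -/
noncomputable def restrictLinear (K : Type*) [Field K] (c : S.faces) :
    FaceRing M K →ₗ[K] AddMonoidAlgebra K (Fin (S.dim c) → ℝ) :=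
  Finsupp.linearCombination K fun b : M.points =>
    if (b : X) ∈ (c : Set X) then AddMonoidAlgebra.single (S.coord c b) 1 else 0

open Classical in
theorem restrictLinear_mono (c : S.faces) (b : M.points) :
    restrictLinear K c (FaceRing.mono b) =
      if (b : X) ∈ (c : Set X) then AddMonoidAlgebra.single (S.coord c b) 1 else 0 := by
  unfold restrictLinear FaceRing.mono
  erw [Finsupp.linearCombination_single]
  rw [one_smul]

theorem restrictLinear_mul_mono (c : S.faces) (b b' : M.points) :
    restrictLinear K c (FaceRing.monoMul b b') =
      restrictLinear K c (FaceRing.mono b) * restrictLinear K c (FaceRing.mono b') := by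
  by_cases h : ∃ z, M.IsSum b b' z
  · obtain ⟨z, hz⟩ := h
    rw [FaceRing.monoMul_of_isSum hz]
    simp only [restrictLinear_mono]
    by_cases hb : (b : X) ∈ (c : Set X) ∧ (b' : X) ∈ (c : Set X)
    · have h1 := coord_mem_monoid b.2 hb.1
      have h2 := coord_mem_monoid b'.2 hb.2
      have h3 := hz.param_eq c h1 h2 (param_coord hb.1) (param_coord hb.2)
      have h4 := M.mem_cone (add_mem h1 h2)
      rw [if_pos hb.1, if_pos hb.2, if_pos (h3 ▸ param_mem h4), ← h3, coord_param h4,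
        AddMonoidAlgebra.single_mul_single, one_mul]
    · have h1 : z ∉ (c : Set X) := by
        obtain ⟨d, m, hm, n, hn, h1, h2, rfl⟩ := hz
        intro hc
        refine hb ?_
        rw [← h1, ← h2]
        exact (S.param_add d c).2 m (M.mem_cone hm) n (M.mem_cone hn) hc
      rw [if_neg h1]
      rcases not_and_or.1 hb with hb | hb
      · rw [if_neg hb, zero_mul]
      · rw [if_neg hb, mul_zero]
  · rw [FaceRing.monoMul_eq_zero h, map_zero]
    simp only [restrictLinear_mono]
    by_cases h1 : (b : X) ∈ (c : Set X)
    · by_cases h2 : (b' : X) ∈ (c : Set X)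
      · exact absurd ⟨_, c, _, coord_mem_monoid b.2 h1, _, coord_mem_monoid b'.2 h2,
          param_coord h1, param_coord h2, rfl⟩ h
      · rw [if_neg h2, mul_zero]
    · rw [if_neg h1, zero_mul]

/-- `restrictLinear` as a homomorphism of algebras. -/
noncomputable def restrict (K : Type*) [Field K] (c : S.faces) :
    FaceRing M K →ₐ[K] AddMonoidAlgebra K (Fin (S.dim c) → ℝ) :=
  AlgHom.ofLinearMap (restrictLinear K c) (by
    change restrictLinear K c FaceRing.unit = 1
    have hne : Nonempty S.faces := ⟨c⟩
    have h0 : SupportedIn (fun e : M.points => e) hne.some 0 := fun e he => by simp at he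
    have h0' : SupportedIn (fun e : M.points => e) c 0 := fun e he => by simp at he
    have h1 := h0.param_vec_eq h0'
    rw [map_zero, map_zero] at h1
    rw [FaceRing.unit, dif_pos hne, restrictLinear_mono]
    simp only [h1]
    rw [if_pos (h1 ▸ param_mem (zero_mem _)), coord_param (zero_mem _),
      AddMonoidAlgebra.one_def]) (by
    have h1 : (FaceRing.mulHom (M := M) (K := K)).compr₂ (restrictLinear K c) =
        (LinearMap.mul K _).compl₁₂ (restrictLinear K c) (restrictLinear K c) :=
      FaceRing.hom_ext fun b => FaceRing.hom_ext fun b' => by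
        rw [LinearMap.compr₂_apply, FaceRing.mulHom_mono, restrictLinear_mul_mono]
        rfl
    exact fun f g => LinearMap.congr_fun₂ h1 f g)

/-- The coefficient of a monomial, as a linear functional on `K[M]`. -/
noncomputable def coeffAt (K : Type*) [Field K] (b : M.points) : FaceRing M K →ₗ[K] K :=
  Finsupp.lapply b

theorem coeff_restrict {b : M.points} (hb : (b : X) ∈ (c : Set X)) (g : FaceRing M K) :
    (restrict K c g).coeff (S.coord c b) = coeffAt K b g := by
  classical
  have : (Finsupp.lapply (S.coord c b) ∘ₗ
      (AddMonoidAlgebra.coeffLinearEquiv K).toLinearMap) ∘ₗ restrictLinear K c =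
        coeffAt K b := by
    refine FaceRing.hom_ext fun b' => ?_
    change (restrictLinear K c (FaceRing.mono b')).coeff (S.coord c b) = Finsupp.single b' 1 b
    rw [restrictLinear_mono]
    by_cases hbb : b' = b
    · rw [hbb, if_pos hb]
      simp
    · rw [Finsupp.single_eq_of_ne (Ne.symm hbb)]
      split_ifs with h
      · rw [AddMonoidAlgebra.coeff_single, Finsupp.single_eq_of_ne]
        intro h1
        refine hbb (Subtype.ext ?_)
        rw [← param_coord h, ← h1, param_coord hb]
      · rfl
  exact LinearMap.congr_fun this g

/-- `K[M]` embeds into the product of the monoid algebras of the `ℝ^{δ_c}`. -/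
theorem mem_presentationIdeal_iff {f : MvPolynomial E K} :
    f ∈ M.presentationIdeal K a ↔
      ∀ c : S.faces,
        monomialHom K {e | (a e : X) ∈ (c : Set X)} (fun e => S.coord c (a e)) f = 0 := by
  have key : ∀ c : S.faces, monomialHom K {e | (a e : X) ∈ (c : Set X)} (fun e => S.coord c (a e)) =
      (restrict K c).comp (aeval fun e => (FaceRing.mono (a e) : FaceRing M K)) := by
    intro c
    refine MvPolynomial.algHom_ext fun e => ?_
    rw [AlgHom.comp_apply, aeval_X, monomialHom, aeval_X]
    exact (restrictLinear_mono c (a e)).symm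
  simp only [key, AlgHom.comp_apply]
  rw [presentationIdeal, RingHom.mem_ker]
  constructor
  · intro h c
    erw [h]
    rw [map_zero]
  · intro h
    refine Finsupp.ext fun b => ?_
    obtain ⟨c, m, hm, hmb⟩ := Set.mem_iUnion.1 b.2
    have hb : (b : X) ∈ (c : Set X) := hmb ▸ param_mem (M.mem_cone hm)
    refine (coeff_restrict hb _).symm.trans ?_
    erw [h c]
    rfl

open Classical in
theorem monomialHom_face_monomial (c : S.faces) (u : E →₀ ℕ) :
    monomialHom K {e | (a e : X) ∈ (c : Set X)} (fun e => S.coord c (a e))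
        (monomial u (1 : K)) =
      if SupportedIn a c u then AddMonoidAlgebra.single (vec a c u) (1 : K) else 0 :=
  (monomialHom_monomial {e | (a e : X) ∈ (c : Set X)} (fun e => S.coord c (a e)) u 1).trans
    (if_congr Iff.rfl rfl rfl)

theorem monomial_mem_presentationIdeal (hu : ∀ c, ¬ SupportedIn a c u) :
    (monomial u 1 : MvPolynomial E K) ∈ M.presentationIdeal K a := by
  classical
  rw [mem_presentationIdeal_iff]
  intro c
  rw [monomialHom_face_monomial, if_neg (hu c)]

theorem monomial_sub_monomial_mem_presentationIdeal (hu : SupportedIn a c u)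
    (hv : SupportedIn a c v) (huv : vec a c u = vec a c v) :
    (monomial u 1 - monomial v 1 : MvPolynomial E K) ∈ M.presentationIdeal K a := by
  classical
  rw [mem_presentationIdeal_iff]
  intro d
  rw [map_sub, monomialHom_face_monomial, monomialHom_face_monomial]
  by_cases hd : SupportedIn a d u
  · obtain ⟨h1, h2⟩ := hu.transfer hv huv hd
    rw [if_pos hd, if_pos h1, h2, sub_self]
  · rw [if_neg hd, if_neg fun h => hd (hv.transfer hu huv.symm h).1, sub_zero]

/-- The sum of the coefficients over all monomials with the same nonzero image in `K[M]` vanishes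
for the elements of the presentation ideal. -/
theorem sum_coeff_eq_zero {f : MvPolynomial E K} (hf : f ∈ M.presentationIdeal K a)
    (c : S.faces) (z : Fin (S.dim c) → ℝ)
    [DecidablePred fun u => SupportedIn a c u ∧ vec a c u = z] :
    ∑ u ∈ f.support, (if SupportedIn a c u ∧ vec a c u = z then MvPolynomial.coeff u f else 0) =
      0 := by
  classical
  have h := coeff_monomialHom {e | (a e : X) ∈ (c : Set X)} (fun e => S.coord c (a e)) f
    subset_rfl z
  rw [mem_presentationIdeal_iff.1 hf c] at h
  refine Eq.trans ?_ h.symm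
  refine Finset.sum_congr rfl fun u _ => ?_
  congr 1

/-! ### Monomials of minimal weight -/

theorem monomial_mem_initialIdeal (hu : ∀ c, ¬ SupportedIn a c u) :
    (monomial u 1 : MvPolynomial E K) ∈ initialIdeal w (M.presentationIdeal K a) := by
  have := weightedHomogeneousComponent_mem_initialIdeal (w := w) (N := weight w u)
    (monomial_mem_presentationIdeal (K := K) hu)
    fun t ht => by rw [Finset.mem_singleton.1 (support_monomial_subset ht)]
  rwa [weightedHomogeneousComponent_monomial, if_pos rfl] at this

theorem initialComponent_binomial_mem (hu : SupportedIn a c u) (hv : SupportedIn a c v)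
    (huv : vec a c u = vec a c v) (hw : weight w v ≤ weight w u) :
    (monomial u 1 - if weight w v = weight w u then monomial v 1 else 0 : MvPolynomial E K) ∈
      initialIdeal w (M.presentationIdeal K a) := by
  classical
  have := weightedHomogeneousComponent_mem_initialIdeal (w := w) (N := weight w u)
    (monomial_sub_monomial_mem_presentationIdeal (K := K) hu hv huv) fun t ht => by
      rcases Finset.mem_union.1 (MvPolynomial.support_sub E _ _ ht) with ht | ht
      · rw [Finset.mem_singleton.1 (support_monomial_subset ht)]
      · rw [Finset.mem_singleton.1 (support_monomial_subset ht)]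
        exact hw
  rwa [map_sub, weightedHomogeneousComponent_monomial, weightedHomogeneousComponent_monomial,
    if_pos rfl] at this

theorem monomial_notMem_initialIdeal (hu : SupportedIn a c u)
    (hmin : ∀ v, SupportedIn a c v → vec a c v = vec a c u → weight w u ≤ weight w v) :
    (monomial u 1 : MvPolynomial E K) ∉ initialIdeal w (M.presentationIdeal K a) := by
  classical
  intro h
  obtain ⟨f, hf, h1, h2⟩ := exists_mem_of_mem_initialIdeal h (weight w u)
  have h3 := sum_coeff_eq_zero hf c (vec a c u)
  have hfu : MvPolynomial.coeff u f = 1 := by rw [h2 u rfl, coeff_monomial, if_pos rfl]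
  rw [Finset.sum_eq_single u, if_pos ⟨hu, rfl⟩, hfu] at h3
  · exact one_ne_zero h3
  · intro v hv hvu
    refine if_neg fun hvc => ?_
    have h4 := h2 v (le_antisymm (h1 v hv) (hmin v hvc.1 hvc.2))
    rw [coeff_monomial, if_neg (Ne.symm hvu)] at h4
    exact mem_support_iff.1 hv h4
  · intro hu'
    rw [notMem_support_iff.1 hu'] at hfu
    exact absurd hfu zero_ne_one

theorem heightsAttained_of_isRadical [Finite E]
    (hrad : (initialIdeal w (M.presentationIdeal K a)).IsRadical) : HeightsAttained a w := by
  classical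
  intro c u hu
  obtain ⟨v, ⟨hv, hvu⟩, hmin⟩ := WellFounded.has_min (measure fun v : E →₀ ℕ => weight w v).wf
    {v | SupportedIn a c v ∧ vec a c v = vec a c u} ⟨u, hu, rfl⟩
  refine ⟨v, hv, hvu, ?_⟩
  obtain ⟨h, -, hh, -, -⟩ := hv.exists_isHeight w
  have hleast := hv.isHeight_iff.1 hh
  rcases (hleast.2 hv.vec_weight_mem).eq_or_lt with h1 | h1
  · rwa [h1] at hh
  obtain ⟨n, -, v', hv', hnv, hlt⟩ := hv.exists_weight_lt hleast.1 h1
  -- the initial component of `X^(n v) - X^v'` is `X^(n v) = (X^v)^n`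
  have h2 : (monomial (n • v) 1 : MvPolynomial E K) ∈
      initialIdeal w (M.presentationIdeal K a) := by
    have h3 := initialComponent_binomial_mem (K := K) (hv.nsmul n) hv' hnv hlt.le
    rwa [if_neg hlt.ne, sub_zero] at h3
  refine absurd (hrad ⟨n, ?_⟩) (monomial_notMem_initialIdeal (K := K) (w := w) hv
    fun v'' h3 h4 => not_lt.1 (hmin v'' ⟨h3, h4.trans hvu⟩))
  rwa [monomial_pow, one_pow]

/-! ### The initial ideal as an intersection of prime ideals -/

/-- The indices of those `a_e` in the face `c` at which the linear function `y` on `C_c` takes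
the value `w_e`. -/
def tightSet (a : E → M.points) (w : E → ℕ) (c : S.faces)
    (y : (Fin (S.dim c) → ℝ) →ₗ[ℝ] ℝ) : Set E :=
  {e | (a e : X) ∈ (c : Set X) ∧ y (S.coord c (a e)) = w e}

theorem SupportedIn.weight_le_and_iff {y : (Fin (S.dim c) → ℝ) →ₗ[ℝ] ℝ} (hu : SupportedIn a c u)
    (hy : ∀ e, (a e : X) ∈ (c : Set X) → y (S.coord c (a e)) ≤ w e) :
    y (vec a c u) ≤ (weight w u : ℕ) ∧
      (y (vec a c u) = (weight w u : ℕ) ↔ ∀ e ∈ u.support, e ∈ tightSet a w c y) := by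
  have h1 : y (vec a c u) = ∑ e ∈ u.support, u e • y (S.coord c (a e)) := by
    rw [vec, map_weight]
    rfl
  have h2 : ((weight w u : ℕ) : ℝ) = ∑ e ∈ u.support, u e • (w e : ℝ) :=
    map_weight (Nat.castAddMonoidHom ℝ) w
  have h3 : ∀ e ∈ u.support, u e • y (S.coord c (a e)) ≤ u e • (w e : ℝ) := fun e he =>
    nsmul_le_nsmul_right (hy e (hu e he)) _
  rw [h1, h2]
  refine ⟨Finset.sum_le_sum h3, (Finset.sum_eq_sum_iff_of_le h3).trans
    (forall₂_congr fun e he => ?_)⟩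
  rw [smul_right_inj (Finsupp.mem_support_iff.1 he)]
  exact (and_iff_right (hu e he)).symm

theorem SupportedIn.of_tightSet {y : (Fin (S.dim c) → ℝ) →ₗ[ℝ] ℝ}
    (h : ∀ e ∈ u.support, e ∈ tightSet a w c y) : SupportedIn a c u :=
  fun e he => (h e he).1

/-- The initial ideal is contained in the prime ideals that belong to the linear functions bounded
by the weights: the monomials of `f` that survive in the monoid algebra have the least weight
in their class, so that either all or none of them belong to the initial component of `f`. -/
theorem initialIdeal_le_ker {y : (Fin (S.dim c) → ℝ) →ₗ[ℝ] ℝ}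
    (hy : ∀ e, (a e : X) ∈ (c : Set X) → y (S.coord c (a e)) ≤ w e) :
    initialIdeal w (M.presentationIdeal K a) ≤
      RingHom.ker (monomialHom K (tightSet a w c y) fun e => S.coord c (a e)) := by
  classical
  refine Ideal.span_le.2 ?_
  rintro _ ⟨f, hf, rfl⟩
  rw [SetLike.mem_coe, RingHom.mem_ker]
  ext z
  have hcoeff : ∀ u, MvPolynomial.coeff u (initialComponent w f) =
      if weight w u = weightedTotalDegree w f then MvPolynomial.coeff u f else 0 := fun u =>
    coeff_weightedHomogeneousComponent _ _ _
  rw [coeff_monomialHom _ _ _ (s := f.support) (fun u hu => by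
    rw [mem_support_iff, hcoeff] at hu
    exact mem_support_iff.2 fun h => hu (by rw [h, ite_self]))]
  change _ = (0 : K)
  by_cases hz : y z = weightedTotalDegree w f
  · refine (Finset.sum_congr rfl fun u hu => ?_).trans (sum_coeff_eq_zero hf c z)
    by_cases huz : SupportedIn a c u ∧ vec a c u = z
    · obtain ⟨h1, h2⟩ := huz.1.weight_le_and_iff hy
      have h3 : weight w u ≤ weightedTotalDegree w f := le_weightedTotalDegree w hu
      rw [huz.2, hz] at h1
      rw [huz.2, hz] at h2
      have h4 : weightedTotalDegree w f = weight w u := le_antisymm (by exact_mod_cast h1) h3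
      rw [if_pos huz, if_pos ⟨h2.1 (by rw [h4]), huz.2⟩, hcoeff, if_pos h4.symm]
    · rw [if_neg huz, if_neg fun h => huz ⟨.of_tightSet h.1, h.2⟩]
  · refine Finset.sum_eq_zero fun u hu => ?_
    split_ifs with h
    · rw [hcoeff, if_neg]
      intro h1
      have h2 := ((SupportedIn.of_tightSet h.1).weight_le_and_iff hy).2.2 h.1
      have h3 : vec a c u = z := h.2
      rw [h1, h3] at h2
      exact hz h2
    · rfl

/-- If all heights are attained, then the initial ideal is the intersection of the prime ideals
that belong to the linear functions bounded by the weights. -/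
theorem mem_initialIdeal_of_forall [Finite E] (hatt : HeightsAttained a w)
    (f : MvPolynomial E K)
    (hf : ∀ (c : S.faces) (y : (Fin (S.dim c) → ℝ) →ₗ[ℝ] ℝ),
      (∀ e, (a e : X) ∈ (c : Set X) → y (S.coord c (a e)) ≤ w e) →
        monomialHom K (tightSet a w c y) (fun e => S.coord c (a e)) f = 0) :
    f ∈ initialIdeal w (M.presentationIdeal K a) := by
  classical
  induction hn : f.support.card using Nat.strong_induction_on generalizing f with
  | _ n ih =>
    by_cases hf0 : f = 0
    · rw [hf0]
      exact zero_mem _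
    obtain ⟨u, hu⟩ := support_nonempty.2 hf0
    -- it suffices to find an element of the initial ideal by which the term at `u` can be removed
    suffices ∃ g ∈ initialIdeal w (M.presentationIdeal K a), g.support ⊆ f.support ∧
        MvPolynomial.coeff u g = 1 by
      obtain ⟨g, hg, hgf, hgu⟩ := this
      have hlt : (f - C (MvPolynomial.coeff u f) * g).support.card < n := by
        rw [← hn]
        refine Finset.card_lt_card ((Finset.ssubset_iff_of_subset fun t ht => ?_).2 ⟨u, hu, ?_⟩)
        · by_contra htf
          rw [mem_support_iff, MvPolynomial.coeff_sub, coeff_C_mul,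
            notMem_support_iff.1 htf, notMem_support_iff.1 fun h => htf (hgf h), mul_zero,
            sub_zero] at ht
          exact ht rfl
        · rw [notMem_support_iff, MvPolynomial.coeff_sub, coeff_C_mul, hgu, mul_one, sub_self]
      have h1 := ih _ hlt (f - C (MvPolynomial.coeff u f) * g) (fun c y hy => by
        rw [map_sub, map_mul, hf c y hy, RingHom.mem_ker.1 (initialIdeal_le_ker hy hg), mul_zero,
          sub_zero]) rfl
      rw [← sub_add_cancel f (C (MvPolynomial.coeff u f) * g)]
      exact add_mem h1 (Ideal.mul_mem_left _ _ hg)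
    have hmono : ∀ t : E →₀ ℕ, (monomial t (1 : K)).support = {t} := fun t => by
      rw [support_monomial, if_neg one_ne_zero]
    by_cases hc : ∃ c, SupportedIn a c u
    swap
    · push Not at hc
      exact ⟨monomial u 1, monomial_mem_initialIdeal hc, by simpa [hmono] using hu, by simp⟩
    obtain ⟨c, hc⟩ := hc
    obtain ⟨v, hv, hvu, hvh⟩ := hatt c u hc
    have hle : weight w v ≤ weight w u := by
      have := (hv.isHeight_iff.1 hvh).2 (hvu ▸ hc.vec_weight_mem)
      exact_mod_cast this
    rcases hle.lt_or_eq with hlt | heq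
    · have h1 := initialComponent_binomial_mem (K := K) hc hv hvu.symm hle
      rw [if_neg hlt.ne, sub_zero] at h1
      exact ⟨monomial u 1, h1, by simpa [hmono] using hu, by simp⟩
    -- `u` has minimal weight, so that a linear function that supports the height at `∑ u_e a_e`
    -- yields a second term of `f` in the same class and of the same weight
    obtain ⟨h, y, hyh, hy, hyu⟩ := hc.exists_isHeight w
    have hhu : h = (weight w u : ℕ) := by
      rw [hvu, heq] at hvh
      exact hyh.unique (param_mem hc.vec_mem_cone) hvh
    have hy' : ∀ e, (a e : X) ∈ (c : Set X) → y (S.coord c (a e)) ≤ w e := fun e he =>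
      hy _ (gen_mem_liftedCone he)
    have h1 := coeff_monomialHom (tightSet a w c y) (fun e => S.coord c (a e)) f subset_rfl
      (vec a c u)
    rw [hf c y hy'] at h1
    have h2 : ∃ t ∈ f.support, t ≠ u ∧ (∀ e ∈ t.support, e ∈ tightSet a w c y) ∧
        vec a c t = vec a c u := by
      by_contra! hcon
      have h4 := h1.trans (Finset.sum_eq_single u
        (fun t ht htu => if_neg fun h => hcon t ht htu h.1 h.2) fun h => absurd hu h)
      rw [if_pos ⟨(hc.weight_le_and_iff hy').2.1 (hyu.trans hhu), rfl⟩] at h4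
      exact mem_support_iff.1 hu h4.symm
    obtain ⟨t, ht, htu, htT, htv⟩ := h2
    have htc : SupportedIn a c t := .of_tightSet htT
    have htw : weight w t = weight w u := by
      have := (htc.weight_le_and_iff hy').2.2 htT
      rw [htv, hyu, hhu] at this
      exact_mod_cast this.symm
    have h3 := initialComponent_binomial_mem (K := K) hc htc htv.symm htw.le
    rw [if_pos htw] at h3
    refine ⟨_, h3, (MvPolynomial.support_sub E _ _).trans ?_, ?_⟩
    · rw [hmono, hmono]
      exact Finset.union_subset (Finset.singleton_subset_iff.2 hu)
        (Finset.singleton_subset_iff.2 ht)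
    · rw [MvPolynomial.coeff_sub, coeff_monomial, coeff_monomial, if_pos rfl, if_neg htu, sub_zero]

theorem isRadical_of_heightsAttained [Finite E] (hatt : HeightsAttained a w) :
    (initialIdeal w (M.presentationIdeal K a)).IsRadical := by
  rintro f ⟨n, hn⟩
  exact mem_initialIdeal_of_forall hatt f fun c y hy =>
    (isPrime_ker_monomialHom _ _).mem_of_pow_mem n (initialIdeal_le_ker hy hn)

end MonoidalComplex

end ToricFace

theorem corollary3p7 {X : Type*} (S : ToricFace.ConicalComplex X)
    (M : ToricFace.MonoidalComplex S) (K : Type*) [Field K]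
    {E : Type*} [Finite E] (a : E → M.points) (ha : M.Generates a) (w : E → ℕ) :
    (ToricFace.initialIdeal w (M.presentationIdeal K a)).IsRadical ↔
      ∀ d : Set X, M.IsFacetSubdivision a w d →
        ∃ c : S.faces, IsLeast {c : S.faces | d ⊆ c} c ∧
          (M.faceMonoid a w c d : Set (Fin (S.dim c) → ℝ)) =
            {m | m ∈ M.monoid c ∧ S.param c m ∈ d} := by
  constructor
  · intro h d hd
    obtain ⟨c', hc', -⟩ := ToricFace.MonoidalComplex.exists_face_chart hd.prop
    obtain ⟨c, hc⟩ := ToricFace.ConicalComplex.exists_isLeast_face hc'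
    exact ⟨c, hc, (ToricFace.MonoidalComplex.heightsAttained_of_isRadical h).faceMonoid_eq ha
      hd.prop hc.1⟩
  · intro h
    refine ToricFace.MonoidalComplex.isRadical_of_heightsAttained
      (ToricFace.MonoidalComplex.heightsAttained_of_faceMonoid_eq fun d hd => ?_)
    obtain ⟨c, hc, hN⟩ := h d hd
    exact ⟨c, hc.1, hN⟩
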